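/- Let $G$ be a countable discrete group and let $\Sigma=(\sigma_n)_{n\ge1}$ be a sofic approximation to $G$: maps $\sigma_n:G\to\mathrm{Sym}(V_n)$, with $V_n$ finite and non-empty, such that for all $g,h\in G$ the proportion of $v\in V_n$ with $\sigma_n^g(\sigma_n^h(v))=\sigma_n^{gh}(v)$ tends to $1$, and for all $g\ne e$ the proportion of $v\in V_n$ with $\sigma_n^g(v)\neq v$ tends to $1$. A $G$-system $(X,\mu,T)$ is a standard Borel probability space with a measurable $\mu$-preserving action $T$ of $G$. **Definitions for processes.** Let $\mathcal X$ be a standard Borel space with a compact metric $d$ generating its $\sigma$-algebra, and let $\mu$ be a probability measure on $\mathcal X^G$ (with the product topology) that is invariant under the right shift $(x_h)_h\mapsto(x_{hg})_h$. For $\mathbf x\in\mathcal X^{V_n}$ and $v\in V_n$ put $\Pi_v^{\sigma_n}(\mathbf x)=(x_{\sigma_n^g(v)})_{g\in G}$ and $P_{\mathbf x}^{\sigma_n}=|V_n|^{-1}\sum_{v}\delta_{\Pi_v^{\sigma_n}(\mathbf x)}$; for a weak$^*$-neighbourhood $\mathcal O$ of $\mu$ put $\Omega(\mathcal O,\sigma_n)=\{\mathbf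 x: P^{\sigma_n}_{\mathbf x}\in\mathcal O\}$. Let $d^{(V_n)}(\mathbf x,\mathbf y)=|V_n|^{-1}\sum_v d(x_v,y_v)$, and let $B_\delta(F)$ denote the open $\delta$-neighbourhood of $F$ for this metric. For $A\subseteq\mathcal X^{V_n}$ let $\mathrm{cov}_\delta(A)$ be the least cardinality of a set $F\subseteq A$ with $A\subseteq B_\delta(F)$, and for a probability measure $\theta$ on $\mathcal X^{V_n}$ let $\mathrm{cov}_{\varepsilon,\delta}(\theta)$ be the least cardinality of a set $F$ with $\theta(B_\delta(F))>1-\varepsilon$. With $\log 0=-\infty$, define $$\mathrm h_\Sigma(\mu)=\sup_{\delta>0}\inf_{\mathcal O}\limsup_{n\to\infty}\tfrac1{|V_n|}\log\mathrm{cov}_\delta(\Omega(\mathcal O,\sigma_n)),\qquad \underline{\mathrm h}_\Sigma(\mu)=\sup_{\delta>0}\inf_{\mathcal O}\liminf_{n\to\infty}\tfrac1{|V_n|}\log\mathrm{cov}_\delta(\Omega(\mathcal O,\sigma_n)).$$ Probability measures $\mu_n$ on $\mathcal X^{V_n}$ *quenched converge* to $\mu$ over $\Sigma$ if, for every weak$^*$-neighbourhood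 $\mathcal O$ of $\mu$, the proportion of $v\in V_n$ with $(\Pi^{\sigma_n}_v)_*\mu_n\in\mathcal O$ tends to $1$ and $\mu_n(\Omega(\mathcal O,\sigma_n))\to1$. They *doubly-quenched converge* to $\mu$ if $\mu_n\times\mu_n$ (on $(\mathcal X\times\mathcal X)^{V_n}$) quenched converges to $\mu\times\mu$ (on $(\mathcal X\times\mathcal X)^G$). Let $$\mathrm h^{\mathrm{dq}}_\Sigma(\mu)=\sup\Big\{\sup_{\delta,\varepsilon>0}\limsup_{i\to\infty}\tfrac1{|V_{n_i}|}\log\mathrm{cov}_{\varepsilon,\delta}(\mu_i)\Big\},$$ where the outer supremum is over all $n_1<n_2<\cdots$ and all $(\mu_i)_i$ that doubly-quenched converge to $\mu$ over $(\sigma_{n_i})_i$ (and $\sup\emptyset=-\infty$). **Systems.** For a $G$-system $(X,\mu,T)$ the quantities $\mathrm h_\Sigma(\mu,T)$, $\underline{\mathrm h}_\Sigma(\mu,T)$, $\mathrm h^{\mathrm{dq}}_\Sigma(\mu,T)$ are those of the isomorphic process on $X^G$ whose law is the image of $\mu$ under $x\mapsto(T^hx)_{h\in G}$, computed with any compact metric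 generating the $\sigma$-algebra of $X$. **Corollary B′.** Let $(X,\mu,T)$ and $(Y,\nu,S)$ be $G$-systems, and let arbitrary compact generating metrics on $X$, $Y$ and $X\times Y$ be used to compute the quantities below. Suppose that $$\mathrm h^{\mathrm{dq}}_\Sigma(\mu,T)=\mathrm h_\Sigma(\mu,T)\quad\text{and}\quad\underline{\mathrm h}_\Sigma(\nu,S)=\mathrm h_\Sigma(\nu,S),$$ or the same with $(X,\mu,T)$ and $(Y,\nu,S)$ exchanged. Then $$\mathrm h_\Sigma(\mu\times\nu,T\times S)=\mathrm h_\Sigma(\mu,T)+\mathrm h_\Sigma(\nu,S),$$ an identity in $[-\infty,+\infty]$ in which the right-hand side is $-\infty$ if either term is $-\infty$. -/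

import Mathlib

open MeasureTheory Filter Topology
open scoped ENNReal

namespace SoficEntropy

universe u v w

/-- `P n v` holds with high probability in `v ∈ V n` (uniform measure) as `n → ∞`. -/
def WithHighProb {V : ℕ → Type*} [∀ n, Fintype (V n)] (P : ∀ n, V n → Prop) : Prop :=
  Tendsto (fun n => ({v | P n v}.ncard : ℝ) / (Fintype.card (V n) : ℝ)) atTop (𝓝 1)

/-- A sofic approximation to the group `G`. -/
structure SoficApprox (G : Type u) [Group G] where
  V : ℕ → Type w
  [fintypeV : ∀ n, Fintype (V n)]
  [nonemptyV : ∀ n, Nonempty (V n)]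
  σ : ∀ n, G → Equiv.Perm (V n)
  mul_whp : ∀ g h : G, WithHighProb fun n v => σ n g (σ n h v) = σ n (g * h) v
  free_whp : ∀ g : G, g ≠ 1 → WithHighProb fun n v => σ n g v ≠ v

attribute [instance] SoficApprox.fintypeV SoficApprox.nonemptyV

/-- The sub-approximation `(σ_{φ i})_i` along a strictly increasing sequence of indices. -/
def SoficApprox.subseq {G : Type u} [Group G] (S : SoficApprox.{u, w} G)
    (φ : ℕ → ℕ) (hφ : StrictMono φ) : SoficApprox.{u, w} G where
  V i := S.V (φ i)
  σ i := S.σ (φ i)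
  mul_whp g h := (S.mul_whp g h).comp hφ.tendsto_atTop
  free_whp g hg := (S.free_whp g hg).comp hφ.tendsto_atTop

section Models

variable {G : Type*} {V : Type*} {X : Type*}

/-- The pullback name of `x ∈ X^V` at the vertex `v`. -/
def pullbackName (σ : G → Equiv.Perm V) (v : V) (x : V → X) : G → X :=
  fun g => x (σ g v)

theorem measurable_pullbackName [MeasurableSpace X] (σ : G → Equiv.Perm V) (v : V) :
    Measurable (pullbackName (X := X) σ v) :=
  measurable_pi_lambda _ fun g => measurable_pi_apply (σ g v)

/-- The empirical distribution of `x ∈ X^V`: the average of the point masses at the pullback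
names of `x`. -/
noncomputable def empirical [Fintype V] [Nonempty V] [MeasurableSpace X]
    (σ : G → Equiv.Perm V) (x : V → X) : ProbabilityMeasure (G → X) :=
  ⟨(Fintype.card V : ℝ≥0∞)⁻¹ • ∑ v, Measure.dirac (pullbackName σ v x), ⟨by
    simp [ENNReal.inv_mul_cancel]⟩⟩

/-- The set `Ω(O, σ)` of `O`-good models over `σ`. -/
def goodModels [Fintype V] [Nonempty V] [MeasurableSpace X]
    (O : Set (ProbabilityMeasure (G → X))) (σ : G → Equiv.Perm V) : Set (V → X) :=
  {x | empirical σ x ∈ O}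

/-- The Hamming average `d^{(V)}` of the metric of `X`. -/
noncomputable def hammingAvg [Fintype V] [MetricSpace X] (x y : V → X) : ℝ :=
  (Fintype.card V : ℝ)⁻¹ * ∑ v, dist (x v) (y v)

/-- The open `δ`-neighbourhood of `F` for the Hamming average metric. -/
def hammingNhd [Fintype V] [MetricSpace X] (δ : ℝ) (F : Set (V → X)) : Set (V → X) :=
  {x | ∃ y ∈ F, hammingAvg x y < δ}

/-- `cov_δ(A, d^{(V)})`: least cardinality of a `δ`-dense subset of `A`. -/
noncomputable def cov [Fintype V] [MetricSpace X] (δ : ℝ) (A : Set (V → X)) : ℕ∞ :=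
  ⨅ (F : Set (V → X)) (_ : F ⊆ A) (_ : A ⊆ hammingNhd δ F), F.encard

/-- `cov_{ε,δ}(ν, d^{(V)})`: least cardinality of a set whose `δ`-neighbourhood has `ν`-measure
greater than `1 - ε`. -/
noncomputable def measureCov [Fintype V] [MetricSpace X] [MeasurableSpace X] (ε δ : ℝ)
    (ν : ProbabilityMeasure (V → X)) : ℕ∞ :=
  ⨅ (F : Set (V → X)) (_ : 1 - ε < (ν : Measure (V → X)).real (hammingNhd δ F)), F.encard

/-- `(1 / |V|) log c`, an extended real number, with `log 0 = -∞`. -/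
noncomputable def rate (V : Type*) [Fintype V] (c : ℕ∞) : EReal :=
  ENNReal.log (c : ℝ≥0∞) / ((Fintype.card V : ℝ) : EReal)

/-- `ν × ν`, regarded as a measure on `(X × X)^I`. -/
noncomputable def square {I : Type*} [MeasurableSpace X] (ν : ProbabilityMeasure (I → X)) :
    ProbabilityMeasure (I → X × X) :=
  (ν.prod ν).map (f := fun p i => (p.1 i, p.2 i)) (by fun_prop : Measurable _).aemeasurable

end Models

section Shift

variable {G : Type u} [Group G] [Countable G]
  {X : Type v} [MetricSpace X] [CompactSpace X] [MeasurableSpace X] [BorelSpace X]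

/-- The sofic entropy of a metric `G`-process; `𝓝 μ` is the weak-* neighbourhood filter. -/
noncomputable def processEntropy (S : SoficApprox.{u, w} G)
    (μ : ProbabilityMeasure (G → X)) : EReal :=
  ⨆ (δ : ℝ) (_ : 0 < δ), ⨅ O ∈ 𝓝 μ,
    limsup (fun n => rate (S.V n) (cov δ (goodModels O (S.σ n)))) atTop

/-- The lower sofic entropy of a metric `G`-process. -/
noncomputable def processLowerEntropy (S : SoficApprox.{u, w} G)
    (μ : ProbabilityMeasure (G → X)) : EReal :=
  ⨆ (δ : ℝ) (_ : 0 < δ), ⨅ O ∈ 𝓝 μ,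
    liminf (fun n => rate (S.V n) (cov δ (goodModels O (S.σ n)))) atTop

/-- Local weak-* convergence of `μs` to `μ` over `S`. -/
def LocalWeakTendsto (S : SoficApprox.{u, w} G) (μs : ∀ n, ProbabilityMeasure (S.V n → X))
    (μ : ProbabilityMeasure (G → X)) : Prop :=
  ∀ O ∈ 𝓝 μ, WithHighProb fun n v =>
    (μs n).map (measurable_pullbackName (S.σ n) v).aemeasurable ∈ O

/-- Quenched convergence of `μs` to `μ` over `S`. -/
def QuenchedTendsto (S : SoficApprox.{u, w} G) (μs : ∀ n, ProbabilityMeasure (S.V n → X))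
    (μ : ProbabilityMeasure (G → X)) : Prop :=
  LocalWeakTendsto S μs μ ∧ ∀ O ∈ 𝓝 μ,
    Tendsto (fun n => (μs n : Measure (S.V n → X)).real (goodModels O (S.σ n))) atTop (𝓝 1)


/-- Doubly-quenched convergence of `μs` to `μ` over `S`: `μs n × μs n`, as a measure on
`(X × X)^{V n}`, quenched converges to `μ × μ`, as a measure on `(X × X)^G`. -/
def DoublyQuenchedTendsto (S : SoficApprox.{u, w} G)
    (μs : ∀ n, ProbabilityMeasure (S.V n → X)) (μ : ProbabilityMeasure (G → X)) : Prop :=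
  QuenchedTendsto S (fun n => square (μs n)) (square μ)

/-- The doubly-quenched model-measure sofic entropy of a metric `G`-process. -/
noncomputable def processDQEntropy (S : SoficApprox.{u, w} G)
    (μ : ProbabilityMeasure (G → X)) : EReal :=
  ⨆ (φ : ℕ → ℕ) (hφ : StrictMono φ)
    (μs : ∀ i, ProbabilityMeasure ((S.subseq φ hφ).V i → X))
    (_ : DoublyQuenchedTendsto (S.subseq φ hφ) μs μ)
    (δ : ℝ) (_ : 0 < δ) (ε : ℝ) (_ : 0 < ε),
    limsup (fun i => rate ((S.subseq φ hφ).V i) (measureCov ε δ (μs i))) atTop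

end Shift

section GSystem

instance measurableConstSMulProd {G X Y : Type*} [MeasurableSpace X] [MeasurableSpace Y] [SMul G X] [SMul G Y]
    [MeasurableConstSMul G X] [MeasurableConstSMul G Y] : MeasurableConstSMul G (X × Y) where
  measurable_const_smul c :=
    (measurable_const_smul c).prodMap (measurable_const_smul c)

variable {G : Type u} [Group G] [Countable G] {X : Type v} [MeasurableSpace X]

/-- A compact generating metric for the measurable space `X`. -/
structure CompactGeneratingMetric (X : Type v) [MeasurableSpace X] where
  metric : MetricSpace X
  compact : CompactSpace X
  borel : BorelSpace X

/-- The law of the `G`-process `x ↦ (h • x)_{h ∈ G}` with state space `X`, which is isomorphic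
to the system `(X, μ)`. -/
noncomputable def orbitLaw (G : Type u) [Group G] [MulAction G X] [MeasurableConstSMul G X]
    (μ : ProbabilityMeasure X) : ProbabilityMeasure (G → X) :=
  μ.map (f := fun x h => h • x)
    (measurable_pi_lambda _ fun h => measurable_const_smul h).aemeasurable

variable [MulAction G X] [MeasurableConstSMul G X]

/-- The sofic entropy `h_Σ(μ, T)`, computed with the compact generating metric `d`. -/
noncomputable def soficEntropy (S : SoficApprox.{u, w} G) (d : CompactGeneratingMetric X)
    (μ : ProbabilityMeasure X) : EReal :=
  letI := d.metric
  haveI := d.compact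
  haveI := d.borel
  processEntropy S (orbitLaw G μ)

/-- The lower sofic entropy of a `G`-system. -/
noncomputable def lowerSoficEntropy (S : SoficApprox.{u, w} G) (d : CompactGeneratingMetric X)
    (μ : ProbabilityMeasure X) : EReal :=
  letI := d.metric
  haveI := d.compact
  haveI := d.borel
  processLowerEntropy S (orbitLaw G μ)

/-- The doubly-quenched model-measure sofic entropy `h^dq_Σ(μ, T)` of a `G`-system. -/
noncomputable def dqEntropy (S : SoficApprox.{u, w} G) (d : CompactGeneratingMetric X)
    (μ : ProbabilityMeasure X) : EReal :=
  letI := d.metric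
  haveI := d.compact
  haveI := d.borel
  processDQEntropy S (orbitLaw G μ)

end GSystem

end SoficEntropy

/-! The sofic entropy of the product is squeezed between two bounds, which the hypotheses force to
coincide.

Upper bound (`processEntropy_le_add`): the coordinate projections of a good model of a joining are
good models of its marginals, so covers of the marginal model spaces multiply to a cover of the
joint one.

Lower bound (`add_le_processEntropy_joining`): the main point, in `exists_nhds_eventually_real_lt`,
is that every sufficiently good model `y` of the second process forms a good product model with most
samples `x` of a doubly-quenched sequence. On test functions `f ⊗ g` with `f` centred, the average
of `f(Π_v x) g(Π_v y)` over `v` must be small for most `x`, uniformly in `y`. Here `y` enters only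
through bounded weights, and `sq_integral_sq_average_le` removes them by Cauchy–Schwarz, leaving the
average of `f(Π_v x) f(Π_v x')` for two independent samples. Doubly-quenched convergence makes this
small. Hence over each point of a separated set of models of the second process lies a section of
almost full measure. A cover of the joint models must then contain, near each such point, enough
points to cover the model measure. This gives the product bound `cov_mul_measureCov_le`.

These bounds use the product metric on `X × Y`. Independence of the metric is the case `φ = id` of
`processEntropy_le_of_map`. Since `φ` is merely measurable, Lusin's theorem gives a large compact
set `K` on which it is continuous. Each letter of a good model is moved to a nearest point of `K`,
which costs little in Hamming distance, and `φ` is then applied letter by letter. -/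

namespace SoficEntropy

universe u w

/-! ### Covering numbers and separated sets in the Hamming metric. -/

section Covering

variable {V W X Y : Type*} [Fintype V] [Fintype W] [MetricSpace X] [MetricSpace Y]

theorem hammingAvg_self (x : V → X) : hammingAvg x x = 0 := by simp [hammingAvg]

theorem hammingAvg_comm (x y : V → X) : hammingAvg x y = hammingAvg y x := by
  simp [hammingAvg, dist_comm]

theorem hammingAvg_triangle (x y z : V → X) :
    hammingAvg x z ≤ hammingAvg x y + hammingAvg y z := by
  simp only [hammingAvg, ← mul_add, ← Finset.sum_add_distrib]
  gcongr
  exact dist_triangle _ _ _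

theorem hammingNhd_mono {δ δ' : ℝ} (h : δ ≤ δ') (F : Set (V → X)) :
    hammingNhd δ F ⊆ hammingNhd δ' F :=
  fun _ ⟨y, hy, hxy⟩ => ⟨y, hy, hxy.trans_le h⟩

theorem measureCov_anti [MeasurableSpace X] {δ δ' : ℝ} (h : δ ≤ δ') (ε : ℝ)
    (θ : ProbabilityMeasure (V → X)) : measureCov ε δ' θ ≤ measureCov ε δ θ :=
  le_iInf₂ fun F hF =>
    iInf₂_le F (hF.trans_le (measureReal_mono (hammingNhd_mono h F)))

theorem exists_encard_eq_cov {δ : ℝ} (hδ : 0 < δ) (A : Set (V → X)) :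
    ∃ F ⊆ A, A ⊆ hammingNhd δ F ∧ F.encard = cov δ A := by
  let I := {F : Set (V → X) // F ⊆ A ∧ A ⊆ hammingNhd δ F}
  have : Nonempty I := ⟨⟨A, subset_rfl, fun x hx => ⟨x, hx, by rwa [hammingAvg_self]⟩⟩⟩
  obtain ⟨F, hF⟩ := ciInf_mem (fun F : I => F.1.encard)
  refine ⟨F.1, F.2.1, F.2.2, hF.trans (le_antisymm ?_ ?_)⟩
  · exact le_iInf₂ fun F hF => le_iInf fun hA => iInf_le (fun F : I => F.1.encard) ⟨F, hF, hA⟩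
  · exact le_iInf fun F => (iInf₂_le F.1 F.2.1).trans (iInf_le _ F.2.2)

/-- A family of centres such that points attached to the same centre are `δ`-close bounds the
covering number. -/
theorem cov_le_encard {ι : Type*} {δ : ℝ} {A : Set (V → X)} (C : Set ι)
    (R : (V → X) → ι → Prop) (hR : ∀ x ∈ A, ∃ c ∈ C, R x c)
    (hA : ∀ x ∈ A, ∀ y ∈ A, ∀ c ∈ C, R x c → R y c → hammingAvg x y < δ) :
    cov δ A ≤ C.encard := by
  classical
  rcases A.eq_empty_or_nonempty with rfl | ⟨x₀, -⟩
  · exact iInf₂_le_of_le ∅ (Set.empty_subset _) (iInf_le_of_le (Set.empty_subset _)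
      (Set.encard_empty.trans_le zero_le))
  -- `cov` admits only centres inside `A`, so each useful centre is replaced by a point of `A`
  -- attached to it; the default `x₀` is never used.
  let s : ι → (V → X) := fun c => if h : ∃ x ∈ A, R x c then h.choose else x₀
  have hs : ∀ c, (∃ x ∈ A, R x c) → s c ∈ A ∧ R (s c) c := fun c h => by
    simpa only [s, dif_pos h] using h.choose_spec
  let C' := {c ∈ C | ∃ x ∈ A, R x c}
  refine (iInf₂_le (s '' C') ?_).trans ((iInf_le _ ?_).trans ((Set.encard_image_le _ _).trans
    (Set.encard_le_encard (Set.sep_subset _ _))))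
  · rintro _ ⟨c, hc, rfl⟩
    exact (hs c hc.2).1
  · intro x hx
    obtain ⟨c, hc, hxc⟩ := hR x hx
    exact ⟨s c, ⟨c, ⟨hc, x, hx, hxc⟩, rfl⟩,
      hA x hx _ (hs c ⟨x, hx, hxc⟩).1 c hc hxc (hs c ⟨x, hx, hxc⟩).2⟩

/-- The factor `2` is the price of arbitrary centres: two images within `δ'` of one centre are only
known to be `2 * δ'`-close. -/
theorem cov_le_of_mapsTo {δ δ' : ℝ} {A : Set (V → X)} {B : Set (W → Y)}
    (T : (V → X) → (W → Y)) (hT : ∀ x ∈ A, T x ∈ B)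
    (h : ∀ x ∈ A, ∀ y ∈ A, hammingAvg (T x) (T y) < 2 * δ' → hammingAvg x y < δ) :
    cov δ A ≤ cov δ' B := by
  refine le_iInf₂ fun F _ => le_iInf fun hB =>
    cov_le_encard F (fun x b => hammingAvg (T x) b < δ') (fun x hx => hB (hT x hx)) ?_
  intro x hx y hy b _ hxb hyb
  have := hammingAvg_triangle (T x) b (T y)
  rw [hammingAvg_comm b] at this
  exact h x hx y hy (by linarith)

theorem cov_le_mul_cov {Z : Type*} [MetricSpace Z] {δ δ₁ δ₂ : ℝ} (hδ₁ : 0 < δ₁) (hδ₂ : 0 < δ₂)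
    {A : Set (V → Z)} {B₁ : Set (V → X)} {B₂ : Set (W → Y)}
    (T₁ : (V → Z) → (V → X)) (T₂ : (V → Z) → (W → Y))
    (hT₁ : ∀ x ∈ A, T₁ x ∈ B₁) (hT₂ : ∀ x ∈ A, T₂ x ∈ B₂)
    (h : ∀ x ∈ A, ∀ y ∈ A, hammingAvg (T₁ x) (T₁ y) < 2 * δ₁ →
      hammingAvg (T₂ x) (T₂ y) < 2 * δ₂ → hammingAvg x y < δ) :
    cov δ A ≤ cov δ₁ B₁ * cov δ₂ B₂ := by
  obtain ⟨F₁, -, hB₁, e₁⟩ := exists_encard_eq_cov hδ₁ B₁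
  obtain ⟨F₂, -, hB₂, e₂⟩ := exists_encard_eq_cov hδ₂ B₂
  rw [← e₁, ← e₂, ← Set.encard_prod]
  refine cov_le_encard _
    (fun x b => hammingAvg (T₁ x) b.1 < δ₁ ∧ hammingAvg (T₂ x) b.2 < δ₂) ?_ ?_
  · intro x hx
    obtain ⟨b₁, h₁, h₁'⟩ := hB₁ (hT₁ x hx)
    obtain ⟨b₂, h₂, h₂'⟩ := hB₂ (hT₂ x hx)
    exact ⟨(b₁, b₂), ⟨h₁, h₂⟩, h₁', h₂'⟩
  · rintro x hx y hy ⟨b₁, b₂⟩ _ ⟨h₁, h₂⟩ ⟨k₁, k₂⟩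
    have t₁ := hammingAvg_triangle (T₁ x) b₁ (T₁ y)
    have t₂ := hammingAvg_triangle (T₂ x) b₂ (T₂ y)
    rw [hammingAvg_comm b₁] at t₁
    rw [hammingAvg_comm b₂] at t₂
    dsimp only at *
    exact h x hx y hy (by linarith) (by linarith)

/-- Maximality alone gives the covering property, since an uncovered point could be added. Covering
bounds `cov` from above, while separation keeps the neighbourhoods of the centres disjoint in the
lower bound. -/
theorem exists_maximal_separated {δ : ℝ} (hδ : 0 < δ) (A : Set (V → X)) :
    ∃ E ⊆ A, A ⊆ hammingNhd δ E ∧ ∀ x ∈ E, ∀ y ∈ E, hammingAvg x y < δ → x = y := by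
  obtain ⟨E, -, hE⟩ := zorn_subset_nonempty
    {E : Set (V → X) | E ⊆ A ∧ ∀ x ∈ E, ∀ y ∈ E, hammingAvg x y < δ → x = y} (by
      intro c hc hchain _
      refine ⟨⋃₀ c, ⟨Set.sUnion_subset fun s hs => (hc hs).1, ?_⟩,
        fun s hs => Set.subset_sUnion_of_mem hs⟩
      rintro x ⟨s, hs, hx⟩ y ⟨t, ht, hy⟩ hxy
      rcases hchain.total hs ht with hst | hts
      · exact (hc ht).2 x (hst hx) y hy hxy
      · exact (hc hs).2 x hx y (hts hy) hxy) ∅ (by simp)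
  refine ⟨E, hE.prop.1, fun x hx => ?_, hE.prop.2⟩
  by_contra hcon
  have hfar : ∀ y ∈ E, ¬ hammingAvg x y < δ := fun y hy h => hcon ⟨y, hy, h⟩
  have hxE : x ∈ E := hE.le_of_ge (y := insert x E) ⟨Set.insert_subset hx hE.prop.1, by
    rintro a (rfl | ha) b (rfl | hb) hab
    · rfl
    · exact absurd hab (hfar b hb)
    · exact absurd (by rwa [hammingAvg_comm] at hab) (hfar a ha)
    · exact hE.prop.2 a ha b hb hab⟩ (Set.subset_insert _ _) (Set.mem_insert _ _)
  exact hfar x hxE (by rwa [hammingAvg_self])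

/-- If all fibres of `p : F → E` have at least `m` points, then `F` has at least `|E| m` points. -/
theorem encard_mul_le_of_fibers {α β : Type*} {E : Set β} {F : Set α} {m : ℕ∞} (p : α → β)
    (hp : ∀ y ∈ E, m ≤ {f ∈ F | p f = y}.encard) : E.encard * m ≤ F.encard := by
  classical
  rcases eq_or_ne m 0 with rfl | hm
  · simp
  rcases F.finite_or_infinite with hF | hF
  swap
  · simp [hF.encard_eq]
  have hEF : E ⊆ p '' F := fun y hy => by
    have h1 : {f ∈ F | p f = y}.encard ≠ 0 := fun h0 => hm (le_antisymm (h0 ▸ hp y hy) zero_le)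
    obtain ⟨f, hf, rfl⟩ := Set.nonempty_of_encard_ne_zero h1
    exact ⟨f, hf, rfl⟩
  have hE : E.Finite := (hF.image p).subset hEF
  lift E to Finset β using hE
  lift F to Finset α using hF
  have hfib : ∀ y : β, {f ∈ (F : Set α) | p f = y}.encard
      = ((F.filter fun f => p f = y).card : ℕ∞) := fun y => by
    rw [← Set.encard_coe_eq_coe_finsetCard]; congr 1; ext; simp
  rcases E.eq_empty_or_nonempty with rfl | ⟨y₀, hy₀⟩
  · simp
  have hmtop : m ≠ ⊤ := fun h => by
    have := hp y₀ hy₀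
    rw [hfib, h, top_le_iff] at this
    exact ENat.natCast_ne_top _ this
  lift m to ℕ using hmtop
  rw [Set.encard_coe_eq_coe_finsetCard, Set.encard_coe_eq_coe_finsetCard]
  norm_cast
  refine (Finset.card_nsmul_le_sum E (fun y => (F.filter fun f => p f = y).card) m ?_).trans ?_
  · intro y hy
    have := hp y hy
    rw [hfib] at this
    exact_mod_cast this
  · rw [← Finset.card_biUnion]
    · exact Finset.card_le_card fun f hf => by simp at hf; exact hf.2
    · intro a _ b _ hab
      refine Finset.disjoint_left.2 fun f hf hf' => hab ?_
      simp at hf hf'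
      exact hf.2.symm.trans hf'.2

end Covering

/-! ### Exponential growth rates of cardinalities. -/

section Rate

variable {V : Type*} [Fintype V]

theorem rate_mono {c c' : ℕ∞} (h : c ≤ c') : rate V c ≤ rate V c' :=
  EReal.div_le_div_right_of_nonneg (by exact_mod_cast Nat.zero_le _)
    (ENNReal.log_le_log (ENat.toENNReal_le.2 h))

theorem rate_mul (c c' : ℕ∞) : rate V (c * c') = rate V c + rate V c' := by
  rw [rate, ENat.toENNReal_mul, ENNReal.log_mul_add,
    EReal.add_div_of_nonneg_right (by exact_mod_cast Nat.zero_le _), rate, rate]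

theorem rate_zero [Nonempty V] : rate V 0 = ⊥ := by
  rw [rate, ENat.toENNReal_zero, ENNReal.log_zero]
  exact EReal.bot_div_of_pos_ne_top (by exact_mod_cast Fintype.card_pos) (EReal.coe_ne_top _)

theorem rate_nonneg {c : ℕ∞} (h : c ≠ 0) : 0 ≤ rate V c :=
  EReal.div_nonneg (ENNReal.zero_le_log_iff.2 (by
    rw [← ENat.toENNReal_one, ENat.toENNReal_le]
    exact Order.one_le_iff_pos.2 (pos_iff_ne_zero.2 h)))
    (by exact_mod_cast Nat.zero_le _)

end Rate

/-! ### Weak convergence tested on multiplicative families. -/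

section WeakConvergence

variable {Z : Type*} [TopologicalSpace Z] [CompactSpace Z] [MeasurableSpace Z]
  [OpensMeasurableSpace Z]

theorem integrable_continuousMap (P : ProbabilityMeasure Z) (f : C(Z, ℝ)) :
    Integrable f (P : Measure Z) :=
  (BoundedContinuousFunction.mkOfCompact f).integrable _

/-- On a compact space, convergence of the integrals of a point-separating multiplicative family
of continuous functions implies weak convergence. -/
theorem tendsto_of_submonoid (M : Submonoid C(Z, ℝ))
    (hM : ∀ x y : Z, x ≠ y → ∃ f ∈ M, f x ≠ f y) {ι : Type*} {l : Filter ι}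
    {P : ι → ProbabilityMeasure Z} {μ : ProbabilityMeasure Z}
    (h : ∀ f ∈ M, Tendsto (fun i => ∫ z, f z ∂(P i : Measure Z)) l
      (𝓝 (∫ z, f z ∂(μ : Measure Z)))) :
    Tendsto P l (𝓝 μ) := by
  let A : Subalgebra ℝ C(Z, ℝ) := Algebra.adjoin ℝ (M : Set C(Z, ℝ))
  have hspan : ∀ f ∈ A, Tendsto (fun i => ∫ z, f z ∂(P i : Measure Z)) l
      (𝓝 (∫ z, f z ∂(μ : Measure Z))) := by
    intro f hf
    -- Since `M` is closed under products, the generated algebra is just its linear span, so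
    -- linearity of the integral suffices.
    replace hf : f ∈ Submodule.span ℝ (M : Set C(Z, ℝ)) := by
      have := (Subalgebra.mem_toSubmodule A).2 hf
      rwa [Algebra.adjoin_eq_span, Submonoid.closure_eq] at this
    induction hf using Submodule.span_induction with
    | mem f hf => exact h f hf
    | zero => simpa using tendsto_const_nhds
    | add f g _ _ hf hg =>
      simpa only [ContinuousMap.add_apply, integral_add (integrable_continuousMap _ f)
        (integrable_continuousMap _ g)] using hf.add hg
    | smul c f _ hf =>
      simpa only [ContinuousMap.smul_apply, integral_smul] using hf.const_smul c
  have hsep : A.SeparatesPoints := fun x y hxy => by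
    obtain ⟨f, hf, hne⟩ := hM x y hxy
    exact ⟨f, ⟨f, Algebra.subset_adjoin hf, rfl⟩, hne⟩
  rw [ProbabilityMeasure.tendsto_iff_forall_integral_tendsto]
  intro f
  rw [Metric.tendsto_nhds]
  intro ε hε
  -- Stone–Weierstrass: `g` is uniformly `ε / 3`-close to `f`, hence so are the integrals against
  -- any probability measure.
  obtain ⟨⟨g, hg⟩, hgf⟩ := ContinuousMap.exists_mem_subalgebra_near_continuousMap_of_separatesPoints
    A hsep f.toContinuousMap (ε / 3) (by positivity)
  have hclose : ∀ Q : ProbabilityMeasure Z,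
      |∫ z, g z ∂(Q : Measure Z) - ∫ z, f z ∂(Q : Measure Z)| ≤ ε / 3 := by
    intro Q
    rw [← integral_sub (integrable_continuousMap Q g) (f.integrable _)]
    have := norm_integral_le_of_norm_le_const (μ := (Q : Measure Z)) (f := fun z => g z - f z)
      (C := ε / 3) (Eventually.of_forall fun z =>
        (ContinuousMap.norm_coe_le_norm (g - f.toContinuousMap) z).trans hgf.le)
    rwa [probReal_univ, mul_one] at this
  filter_upwards [Metric.tendsto_nhds.1 (hspan g hg) (ε / 3) (by positivity)] with i hi
  rw [Real.dist_eq] at *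
  have h1 := abs_le.1 (hclose (P i))
  have h2 := abs_le.1 (hclose μ)
  have h3 := abs_lt.1 hi
  rw [abs_lt]
  constructor <;> linarith [h1.1, h1.2, h2.1, h2.2, h3.1, h3.2]

theorem eventually_abs_integral_sub_lt (μ : ProbabilityMeasure Z) (f : C(Z, ℝ)) {ε : ℝ}
    (hε : 0 < ε) : ∀ᶠ P : ProbabilityMeasure Z in 𝓝 μ,
      |∫ z, f z ∂(P : Measure Z) - ∫ z, f z ∂(μ : Measure Z)| < ε := by
  have := (ProbabilityMeasure.tendsto_iff_forall_integral_tendsto.1 (tendsto_id (x := 𝓝 μ)))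
    (BoundedContinuousFunction.mkOfCompact f)
  exact Metric.tendsto_nhds.1 this ε hε

end WeakConvergence

/-! ### Empirical distributions of models. -/

section Empirical

variable {G V X Y : Type*} [Fintype V] [Nonempty V] [MeasurableSpace X] [MeasurableSpace Y]

theorem integral_empirical (σ : G → Equiv.Perm V) (x : V → X) {f : (G → X) → ℝ}
    (hf : StronglyMeasurable f) :
    ∫ z, f z ∂(empirical σ x : Measure (G → X)) =
      (Fintype.card V : ℝ)⁻¹ * ∑ v, f (pullbackName σ v x) := by
  change ∫ z, f z ∂((Fintype.card V : ℝ≥0∞)⁻¹ • ∑ v, Measure.dirac (pullbackName σ v x)) = _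
  rw [integral_smul_measure, integral_finsetSum_measure]
  · simp [integral_dirac' _ _ hf]
  · exact fun v _ => integrable_dirac' hf (by finiteness)

theorem empirical_map (σ : G → Equiv.Perm V) (x : V → X) {φ : X → Y}
    (hφ' : Measurable fun (z : G → X) g => φ (z g)) :
    (empirical σ x).map hφ'.aemeasurable = empirical σ (fun v => φ (x v)) := by
  apply Subtype.ext
  change Measure.map _ ((Fintype.card V : ℝ≥0∞)⁻¹ • ∑ v, Measure.dirac (pullbackName σ v x)) =
    (Fintype.card V : ℝ≥0∞)⁻¹ • ∑ v, Measure.dirac (pullbackName σ v fun v => φ (x v))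
  rw [Measure.map_smul]
  congr 1
  rw [← Measure.mapₗ_apply_of_measurable hφ', map_sum]
  refine Finset.sum_congr rfl fun v _ => ?_
  rw [Measure.mapₗ_apply_of_measurable hφ', Measure.map_dirac' hφ']
  rfl

end Empirical

/-- Averages over a single coordinate do not see the permutation. -/
theorem sum_pullbackName {G V X : Type*} [Fintype V] (σ : G → Equiv.Perm V) (x : V → X) (g : G)
    (f : X → ℝ) : ∑ v, f (pullbackName σ v x g) = ∑ v, f (x v) :=
  Equiv.sum_comp (σ g) (fun v => f (x v))

theorem hammingAvg_prod_le {V X Y : Type*} [Fintype V] [MetricSpace X] [MetricSpace Y]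
    (x y : V → X × Y) :
    hammingAvg x y ≤ hammingAvg (fun v => (x v).1) (fun v => (y v).1) +
      hammingAvg (fun v => (x v).2) (fun v => (y v).2) := by
  simp only [hammingAvg, ← mul_add, ← Finset.sum_add_distrib]
  gcongr
  exact max_le_add_of_nonneg dist_nonneg dist_nonneg

/-! ### Subadditivity for joinings. -/

section Upper

variable {V : ℕ → Type*} [∀ n, Fintype (V n)] [∀ n, Nonempty (V n)]

/-- A non-zero cardinality has non-negative rate, so a negative limsup forces `c n = 0` eventually;
the resulting `⊥` absorbs the other summand, even `⊤`. -/
theorem limsup_rate_add_eq_bot {c c' : ℕ → ℕ∞}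
    (h : limsup (fun n => rate (V n) (c n)) atTop < 0) :
    limsup (fun n => rate (V n) (c n) + rate (V n) (c' n)) atTop = ⊥ := by
  refine le_bot_iff.1 (limsup_le_of_le isCobounded_le_of_bot ?_)
  filter_upwards [eventually_lt_of_limsup_lt h] with n hn
  have : c n = 0 := by
    by_contra h0
    exact absurd hn (not_lt.2 (rate_nonneg h0))
  rw [this, rate_zero, EReal.bot_add]

variable {G : Type u} [Countable G]
  {X : Type*} [MetricSpace X] [CompactSpace X] [MeasurableSpace X] [BorelSpace X]
  {Y : Type*} [MetricSpace Y] [CompactSpace Y] [MeasurableSpace Y] [BorelSpace Y]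

/-- Applying `φ` letter by letter commutes with taking empirical distributions, and push-forward by
a continuous map is weak-* continuous. The neighbourhood is therefore uniform in `V` and `σ`. -/
theorem exists_nhds_empirical_map (κ : ProbabilityMeasure (G → X)) {φ : X → Y}
    (hφ : Continuous φ) {μ : ProbabilityMeasure (G → Y)}
    (hμ : Measure.map (fun z g => φ (z g)) (κ : Measure (G → X)) = μ)
    {O : Set (ProbabilityMeasure (G → Y))} (hO : O ∈ 𝓝 μ) :
    ∃ U ∈ 𝓝 κ, ∀ (V : Type w) [Fintype V] [Nonempty V] (σ : G → Equiv.Perm V) (x : V → X),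
      empirical σ x ∈ U → empirical σ (fun v => φ (x v)) ∈ O := by
  have hc : Continuous fun (z : G → X) g => φ (z g) := by fun_prop
  refine ⟨_, (ProbabilityMeasure.continuous_map hc).continuousAt.preimage_mem_nhds
    (t := O) ?_, fun V _ _ σ x hx => ?_⟩
  · convert hO
    exact Subtype.ext hμ
  · rw [← empirical_map σ x hc.measurable]
    exact hx

variable [Group G]

theorem exists_nhds_limsup_lt (S : SoficApprox.{u, w} G) (μ : ProbabilityMeasure (G → X))
    {δ : ℝ} (hδ : 0 < δ) {a : EReal} (ha : processEntropy S μ < a) :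
    ∃ O ∈ 𝓝 μ, limsup (fun n => rate (S.V n) (cov δ (goodModels O (S.σ n)))) atTop < a := by
  have : ⨅ O ∈ 𝓝 μ, limsup (fun n => rate (S.V n) (cov δ (goodModels O (S.σ n)))) atTop < a :=
    (le_iSup₂_of_le (f := fun (δ : ℝ) (_ : 0 < δ) => ⨅ O ∈ 𝓝 μ,
      limsup (fun n => rate (S.V n) (cov δ (goodModels O (S.σ n)))) atTop) δ hδ le_rfl).trans_lt ha
  simpa only [iInf_lt_iff, exists_prop] using this

/-- Subadditivity of sofic entropy under joinings. -/
theorem processEntropy_le_add (S : SoficApprox.{u, w} G) (κ : ProbabilityMeasure (G → X × Y))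
    (μ : ProbabilityMeasure (G → X)) (ν : ProbabilityMeasure (G → Y))
    (hμ : Measure.map (fun z g => (z g).1) (κ : Measure (G → X × Y)) = μ)
    (hν : Measure.map (fun z g => (z g).2) (κ : Measure (G → X × Y)) = ν) :
    processEntropy S κ ≤ processEntropy S μ + processEntropy S ν := by
  refine iSup₂_le fun δ hδ => ?_
  -- Models sharing both centres are `δ / 2`-close in each factor, and the product distance is at
  -- most the sum.
  have hδ4 : 0 < δ / 4 := by positivity
  have key : ∀ O₁ ∈ 𝓝 μ, ∀ O₂ ∈ 𝓝 ν,
      ⨅ O ∈ 𝓝 κ, limsup (fun n => rate (S.V n) (cov δ (goodModels O (S.σ n)))) atTop ≤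
      limsup (fun n => rate (S.V n) (cov (δ / 4) (goodModels O₁ (S.σ n))) +
        rate (S.V n) (cov (δ / 4) (goodModels O₂ (S.σ n)))) atTop := by
    intro O₁ hO₁ O₂ hO₂
    obtain ⟨U₁, hU₁, h₁⟩ := exists_nhds_empirical_map.{u, w} κ continuous_fst hμ hO₁
    obtain ⟨U₂, hU₂, h₂⟩ := exists_nhds_empirical_map.{u, w} κ continuous_snd hν hO₂
    refine iInf₂_le_of_le (U₁ ∩ U₂) (inter_mem hU₁ hU₂) ?_
    refine limsup_le_limsup (Eventually.of_forall fun n => ?_)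
    dsimp only
    rw [← rate_mul]
    refine rate_mono (cov_le_mul_cov hδ4 hδ4 (fun x v => (x v).1) (fun x v => (x v).2)
      (fun x hx => h₁ _ _ x hx.1) (fun x hx => h₂ _ _ x hx.2) fun x _ y _ hx hy => ?_)
    linarith [hammingAvg_prod_le x y]
  -- The value `⊥` is treated apart, because approximating both summands from above says nothing
  -- about `⊥ + ⊤`.
  rcases eq_or_ne (processEntropy S μ) ⊥ with hb | hμb
  · obtain ⟨O₁, hO₁, hl⟩ := exists_nhds_limsup_lt S μ hδ4 (a := 0)
      (by rw [hb]; exact EReal.bot_lt_zero)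
    refine (key O₁ hO₁ Set.univ univ_mem).trans ?_
    rw [limsup_rate_add_eq_bot hl]
    exact bot_le
  rcases eq_or_ne (processEntropy S ν) ⊥ with hb | hνb
  · obtain ⟨O₂, hO₂, hl⟩ := exists_nhds_limsup_lt S ν hδ4 (a := 0)
      (by rw [hb]; exact EReal.bot_lt_zero)
    refine (key Set.univ univ_mem O₂ hO₂).trans ?_
    simp only [add_comm (rate _ (cov (δ / 4) (goodModels Set.univ _)))]
    rw [limsup_rate_add_eq_bot hl]
    exact bot_le
  refine EReal.le_add_of_forall_gt (Or.inl hμb) (Or.inr hνb) fun a ha b hb => ?_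
  obtain ⟨O₁, hO₁, h₁⟩ := exists_nhds_limsup_lt S μ hδ4 ha
  obtain ⟨O₂, hO₂, h₂⟩ := exists_nhds_limsup_lt S ν hδ4 hb
  refine (key O₁ hO₁ O₂ hO₂).trans (limsup_le_of_le isCobounded_le_of_bot ?_)
  filter_upwards [eventually_lt_of_limsup_lt h₁, eventually_lt_of_limsup_lt h₂] with n hn hn'
  exact add_le_add hn.le hn'.le

end Upper

/-! ### A decoupling inequality for weighted averages. -/

section SecondMoment

variable {Ω V : Type*} [MeasurableSpace Ω] [Fintype V]

theorem abs_average_le [Nonempty V] {a : V → ℝ} {B : ℝ} (h : ∀ v, |a v| ≤ B) :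
    |(Fintype.card V : ℝ)⁻¹ * ∑ v, a v| ≤ B := by
  have hc : (0 : ℝ) < Fintype.card V := by exact_mod_cast Fintype.card_pos
  rw [abs_mul, abs_of_pos (inv_pos.2 hc), inv_mul_le_iff₀ hc]
  refine (Finset.abs_sum_le_sum_abs _ _).trans ((Finset.sum_le_sum fun v _ => h v).trans ?_)
  simp

theorem integrable_of_bounded {θ : Measure Ω} [IsFiniteMeasure θ] {f : Ω → ℝ} (hf : Measurable f)
    {B : ℝ} (h : ∀ x, |f x| ≤ B) : Integrable f θ :=
  Integrable.of_bound hf.aestronglyMeasurable B (Eventually.of_forall h)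

/-- The second moment of a weighted average of random variables is controlled, uniformly in the
bounded weights, by the first absolute moment of the average of the products of two independent
copies. -/
theorem sq_integral_sq_average_le [Nonempty V] (θ : Measure Ω) [IsProbabilityMeasure θ]
    {Φ : V → Ω → ℝ} (hΦ : ∀ v, Measurable (Φ v)) {B C : ℝ} (hB : ∀ v x, |Φ v x| ≤ B)
    {g : V → ℝ} (hg : ∀ v, |g v| ≤ C) :
    (∫ x, ((Fintype.card V : ℝ)⁻¹ * ∑ v, Φ v x * g v) ^ 2 ∂θ) ^ 2 ≤
      C ^ 2 * ((B * C) ^ 2 *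
        ∫ p, |(Fintype.card V : ℝ)⁻¹ * ∑ v, Φ v p.1 * Φ v p.2| ∂(θ.prod θ)) := by
  set N : ℝ := (Fintype.card V : ℝ)⁻¹ with hN
  have hN0 : 0 ≤ N := by positivity
  have hc : (0 : ℝ) < Fintype.card V := by exact_mod_cast Fintype.card_pos
  have hB0 : 0 ≤ B := by
    obtain ⟨x⟩ := θ.nonempty_of_neZero
    exact (abs_nonneg _).trans (hB (Classical.arbitrary V) x)
  have hC0 : 0 ≤ C := (abs_nonneg _).trans (hg (Classical.arbitrary V))
  let a : Ω → ℝ := fun x => N * ∑ v, Φ v x * g v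
  have ha : Measurable a := by fun_prop
  have haB : ∀ x, |a x| ≤ B * C := fun x => abs_average_le fun v => by
    rw [abs_mul]; exact mul_le_mul (hB v x) (hg v) (abs_nonneg _) hB0
  have hint : ∀ v, Integrable (fun x => Φ v x * a x) θ := fun v =>
    integrable_of_bounded ((hΦ v).mul ha) (B := B * (B * C)) fun x => by
      rw [abs_mul]; exact mul_le_mul (hB v x) (haB x) (abs_nonneg _) hB0
  let J : V → ℝ := fun v => ∫ x, Φ v x * a x ∂θ
  -- Only one factor of `a x ^ 2` is expanded, so that the weights stand outside the integrals `J
  -- v`.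
  have h1 : ∫ x, a x ^ 2 ∂θ = N * ∑ v, g v * J v := by
    have : ∀ x, a x ^ 2 = N * ∑ v, g v * (Φ v x * a x) := fun x => by
      rw [sq]
      nth_rw 1 [show a x = N * ∑ v, Φ v x * g v from rfl]
      rw [mul_assoc, Finset.sum_mul]
      congr 1
      exact Finset.sum_congr rfl fun v _ => by ring
    simp_rw [this, J]
    rw [integral_const_mul, integral_finsetSum _ fun v _ => (hint v).const_mul _]
    simp_rw [integral_const_mul]
  -- Cauchy–Schwarz over the vertices: the explicit weights leave only their bound `C`.
  have h2 : (N * ∑ v, g v * J v) ^ 2 ≤ C ^ 2 * (N * ∑ v, J v ^ 2) := by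
    have hcs := Finset.sum_mul_sq_le_sq_mul_sq Finset.univ g J
    have hg2 : ∑ v, g v ^ 2 ≤ Fintype.card V * C ^ 2 := by
      refine (Finset.sum_le_sum fun v _ => sq_le_sq' (neg_le_of_abs_le (hg v))
        (le_of_abs_le (hg v))).trans ?_
      simp
    have hJ2 : 0 ≤ ∑ v, J v ^ 2 := Finset.sum_nonneg fun v _ => sq_nonneg _
    calc (N * ∑ v, g v * J v) ^ 2 = N ^ 2 * (∑ v, g v * J v) ^ 2 := by ring
      _ ≤ N ^ 2 * ((Fintype.card V * C ^ 2) * ∑ v, J v ^ 2) := by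
        gcongr
        exact hcs.trans (by gcongr)
      _ = C ^ 2 * (N * ∑ v, J v ^ 2) := by
        rw [hN]; field_simp
  -- Fubini turns each `J v ^ 2` into an integral over two independent copies. The weights left
  -- inside `a` matter only through `|a| ≤ B * C`.
  have h3 : N * ∑ v, J v ^ 2 =
      ∫ p, (N * ∑ v, Φ v p.1 * Φ v p.2) * (a p.1 * a p.2) ∂(θ.prod θ) := by
    have : ∀ p : Ω × Ω, (N * ∑ v, Φ v p.1 * Φ v p.2) * (a p.1 * a p.2) =
        N * ∑ v, (Φ v p.1 * a p.1) * (Φ v p.2 * a p.2) := fun p => by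
      rw [mul_assoc, Finset.sum_mul]
      congr 1
      exact Finset.sum_congr rfl fun v _ => by ring
    simp_rw [this]
    rw [integral_const_mul, integral_finsetSum _ fun v _ => (hint v).mul_prod (hint v)]
    congr 1
    refine Finset.sum_congr rfl fun v _ => ?_
    rw [integral_prod_mul (fun x => Φ v x * a x) (fun x => Φ v x * a x), sq]
  have hA : Measurable fun p : Ω × Ω => N * ∑ v, Φ v p.1 * Φ v p.2 := by fun_prop
  have hAB : ∀ p : Ω × Ω, |N * ∑ v, Φ v p.1 * Φ v p.2| ≤ B * B := fun p =>
    abs_average_le fun v => by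
      rw [abs_mul]; exact mul_le_mul (hB v _) (hB v _) (abs_nonneg _) hB0
  have haa : ∀ p : Ω × Ω, |a p.1 * a p.2| ≤ (B * C) ^ 2 := fun p => by
    rw [abs_mul, sq]
    exact mul_le_mul (haB _) (haB _) (abs_nonneg _) (by positivity)
  have hAi := integrable_of_bounded (θ := θ.prod θ) hA hAB
  calc (∫ x, a x ^ 2 ∂θ) ^ 2 ≤ C ^ 2 * (N * ∑ v, J v ^ 2) := by rw [h1]; exact h2
    _ ≤ _ := by
      rw [h3]
      gcongr
      rw [← integral_const_mul]
      have ham : Measurable fun p : Ω × Ω => a p.1 * a p.2 := by fun_prop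
      refine integral_mono
        (integrable_of_bounded (hA.mul ham) (B := B * B * (B * C) ^ 2) fun p => ?_)
        (hAi.abs.const_mul _) fun p => ?_
      · rw [abs_mul]
        exact mul_le_mul (hAB p) (haa p) (abs_nonneg _) (by positivity)
      · refine (le_abs_self _).trans ?_
        rw [abs_mul, mul_comm]
        gcongr
        exact haa p

/-- Splitting at the level `κ`; this upgrades convergence in probability of bounded variables to
convergence in mean. -/
theorem integral_abs_le_add {θ : Measure Ω} [IsProbabilityMeasure θ] {f : Ω → ℝ}
    (hf : Measurable f) {B κ : ℝ} (h : ∀ x, |f x| ≤ B) (hκ : 0 ≤ κ) :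
    ∫ x, |f x| ∂θ ≤ κ + B * θ.real {x | |f x| < κ}ᶜ := by
  have hs : MeasurableSet {x | |f x| < κ} := measurableSet_lt hf.abs measurable_const
  have hi : Integrable (fun x => κ + {x | |f x| < κ}ᶜ.indicator (fun _ => B) x) θ :=
    (integrable_const _).add ((integrable_const _).indicator hs.compl)
  refine (integral_mono (integrable_of_bounded hf h).abs hi fun x => ?_).trans ?_
  · by_cases hx : |f x| < κ
    · simp [hx, hx.le]
    · have : x ∈ {x | |f x| < κ}ᶜ := hx
      simp only [Set.indicator_of_mem this]
      linarith [h x]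
  · rw [integral_add (integrable_const _) ((integrable_const _).indicator hs.compl),
      integral_indicator hs.compl]
    simp [mul_comm]

end SecondMoment

/-! ### Independent joinings. -/

section Joining

variable {I X Y : Type*} [MeasurableSpace X] [MeasurableSpace Y]

/-- The product of two measures on `X^I` and `Y^I`, regarded as a measure on `(X × Y)^I`. -/
noncomputable def joining (μ : ProbabilityMeasure (I → X)) (ν : ProbabilityMeasure (I → Y)) :
    ProbabilityMeasure (I → X × Y) :=
  (μ.prod ν).map (f := fun p i => (p.1 i, p.2 i)) (by fun_prop : Measurable _).aemeasurable

theorem coe_joining (μ : ProbabilityMeasure (I → X)) (ν : ProbabilityMeasure (I → Y)) :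
    (joining μ ν : Measure (I → X × Y)) =
      Measure.map (fun p i => (p.1 i, p.2 i)) ((μ : Measure (I → X)).prod (ν : Measure (I → Y))) :=
  rfl

theorem integral_joining_mul (μ : ProbabilityMeasure (I → X)) (ν : ProbabilityMeasure (I → Y))
    {f : (I → X) → ℝ} {g : (I → Y) → ℝ} (hf : Measurable f) (hg : Measurable g) :
    ∫ z, f (fun i => (z i).1) * g (fun i => (z i).2) ∂(joining μ ν : Measure (I → X × Y)) =
      (∫ x, f x ∂(μ : Measure (I → X))) * ∫ y, g y ∂(ν : Measure (I → Y)) := by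
  rw [coe_joining, integral_map (by fun_prop : Measurable _).aemeasurable (by
    exact Measurable.aestronglyMeasurable (by fun_prop))]
  exact integral_prod_mul f g

theorem joining_map_fst (μ : ProbabilityMeasure (I → X)) (ν : ProbabilityMeasure (I → Y)) :
    Measure.map (fun z i => (z i).1) (joining μ ν : Measure (I → X × Y)) = μ := by
  rw [coe_joining, Measure.map_map (by fun_prop) (by fun_prop)]
  exact Measure.fst_prod

theorem joining_map_snd (μ : ProbabilityMeasure (I → X)) (ν : ProbabilityMeasure (I → Y)) :
    Measure.map (fun z i => (z i).2) (joining μ ν : Measure (I → X × Y)) = ν := by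
  rw [coe_joining, Measure.map_map (by fun_prop) (by fun_prop)]
  exact Measure.snd_prod

end Joining

/-! ### Concentration under doubly-quenched convergence. -/

section DoublyQuenched

variable {G : Type u} [Group G] [Countable G]
  {X : Type*} [MetricSpace X] [CompactSpace X] [MeasurableSpace X] [BorelSpace X]
  {Y : Type*} [MetricSpace Y] [CompactSpace Y] [MeasurableSpace Y] [BorelSpace Y]

/-- The average is the empirical integral of `f ⊗ f` along the pair of samples, and `f ⊗ f` has
integral zero under `square μ`. Good-model concentration for the squared measures makes it small in
probability, and boundedness makes it small in mean. -/
theorem tendsto_integral_abs_average_mul {S : SoficApprox.{u, w} G}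
    {μs : ∀ n, ProbabilityMeasure (S.V n → X)} {μ : ProbabilityMeasure (G → X)}
    (hμ : DoublyQuenchedTendsto S μs μ) (f : C(G → X, ℝ))
    (hf : ∫ x, f x ∂(μ : Measure (G → X)) = 0) :
    Tendsto (fun n => ∫ p, |(Fintype.card (S.V n) : ℝ)⁻¹ * ∑ v,
        f (pullbackName (S.σ n) v p.1) * f (pullbackName (S.σ n) v p.2)|
        ∂((μs n : Measure (S.V n → X)).prod (μs n : Measure (S.V n → X)))) atTop (𝓝 0) := by
  let F : C(G → X × X, ℝ) :=
    ⟨fun z => f (fun g => (z g).1) * f (fun g => (z g).2), by fun_prop⟩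
  have hF0 : ∫ z, F z ∂(square μ : Measure (G → X × X)) = 0 := by
    refine (integral_joining_mul μ μ f.continuous.measurable f.continuous.measurable).trans ?_
    rw [hf, zero_mul]
  have hπ : ∀ n (v : S.V n), Measurable fun x : S.V n → X => f (pullbackName (S.σ n) v x) :=
    fun n v => f.continuous.measurable.comp (measurable_pullbackName _ v)
  let A : ∀ n, (S.V n → X) × (S.V n → X) → ℝ := fun n p => (Fintype.card (S.V n) : ℝ)⁻¹ * ∑ v,
        f (pullbackName (S.σ n) v p.1) * f (pullbackName (S.σ n) v p.2)
  have hA : ∀ n, Measurable (A n) := fun n => (Finset.measurable_sum _ fun v _ =>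
    ((hπ n v).comp measurable_fst).mul ((hπ n v).comp measurable_snd)).const_mul _
  have hAB : ∀ n p, |A n p| ≤ ‖f‖ * ‖f‖ := fun n p => abs_average_le fun v => by
    rw [abs_mul]
    exact mul_le_mul (f.norm_coe_le_norm _) (f.norm_coe_le_norm _) (abs_nonneg _) (norm_nonneg _)
  have hmain : ∀ κ > 0, Tendsto (fun n => ((μs n : Measure (S.V n → X)).prod
      (μs n : Measure (S.V n → X))).real {p | |A n p| < κ}ᶜ) atTop (𝓝 0) := by
    intro κ hκ
    have h1 := hμ.2 _ (eventually_abs_integral_sub_lt (square μ) F hκ)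
    have h2 : ∀ n, ((μs n : Measure (S.V n → X)).prod
        (μs n : Measure (S.V n → X))).real {p | |A n p| < κ}ᶜ = 1 -
        (square (μs n) : Measure (S.V n → X × X)).real (goodModels {P | |∫ z, F z ∂(P : Measure _)
          - ∫ z, F z ∂(square μ : Measure (G → X × X))| < κ} (S.σ n)) := by
      intro n
      have hs : MeasurableSet {p | |A n p| < κ} := measurableSet_lt (hA n).abs measurable_const
      rw [probReal_compl_eq_one_sub hs]
      congr 1
      have hg : goodModels {P | |∫ z, F z ∂(P : Measure _)
          - ∫ z, F z ∂(square μ : Measure (G → X × X))| < κ} (S.σ n) =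
          {z : S.V n → X × X | |A n (fun v => (z v).1, fun v => (z v).2)| < κ} := by
        ext z
        simp only [goodModels, Set.mem_ofPred_eq, hF0, sub_zero]
        rw [integral_empirical _ _ F.continuous.measurable.stronglyMeasurable]
        rfl
      have hgm : MeasurableSet {z : S.V n → X × X |
          |A n (fun v => (z v).1, fun v => (z v).2)| < κ} :=
        measurableSet_lt ((hA n).comp (by fun_prop)).abs measurable_const
      rw [hg]
      change _ = (Measure.map (fun (p : (S.V n → X) × (S.V n → X)) i => (p.1 i, p.2 i)) _ :
        Measure (S.V n → X × X)).real _
      rw [map_measureReal_apply (by fun_prop) hgm]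
      rfl
    simp_rw [h2]
    simpa using h1.const_sub 1
  rw [Metric.tendsto_nhds]
  intro κ hκ
  have h3 := (hmain (κ / 2) (by positivity)).const_mul (‖f‖ * ‖f‖)
  rw [mul_zero] at h3
  filter_upwards [h3.eventually_lt_const (show 0 < κ / 2 by positivity)] with n hn
  rw [Real.dist_0_eq_abs, abs_of_nonneg (integral_nonneg fun p => abs_nonneg _)]
  have := integral_abs_le_add (θ := (μs n : Measure (S.V n → X)).prod
      (μs n : Measure (S.V n → X))) (hA n) (hAB n) (show 0 ≤ κ / 2 by positivity)
  change ∫ p, |A n p| ∂_ < κ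
  linarith

/-- Under doubly-quenched convergence, weighted averages of a centred observable concentrate at
zero, uniformly in the bounded weights. -/
theorem eventually_forall_weights_real_lt {S : SoficApprox.{u, w} G}
    {μs : ∀ n, ProbabilityMeasure (S.V n → X)} {μ : ProbabilityMeasure (G → X)}
    (hμ : DoublyQuenchedTendsto S μs μ) (f : C(G → X, ℝ))
    (hf : ∫ x, f x ∂(μ : Measure (G → X)) = 0) (C : ℝ) {η ε : ℝ} (hη : 0 < η) (hε : 0 < ε) :
    ∀ᶠ n in atTop, ∀ g : S.V n → ℝ, (∀ v, |g v| ≤ C) →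
      (μs n : Measure (S.V n → X)).real {x | η ≤ |(Fintype.card (S.V n) : ℝ)⁻¹ *
        ∑ v, f (pullbackName (S.σ n) v x) * g v|} < ε := by
  have h1 := ((tendsto_integral_abs_average_mul hμ f hf).const_mul
    ((‖f‖ * C) ^ 2)).const_mul (C ^ 2)
  rw [mul_zero, mul_zero] at h1
  -- The decoupling inequality bounds the square of the second moment; a second moment below `η ^ 2
  -- * ε` is what Chebyshev's inequality needs.
  filter_upwards [h1.eventually_lt_const (show 0 < (η ^ 2 * ε) ^ 2 by positivity)] with n hn g hg
  have hπ : ∀ v : S.V n, Measurable fun x : S.V n → X => f (pullbackName (S.σ n) v x) :=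
    fun v => f.continuous.measurable.comp (measurable_pullbackName _ v)
  have h2 := sq_integral_sq_average_le (μs n : Measure (S.V n → X)) hπ
    (fun v x => f.norm_coe_le_norm _) hg
  have h3 := lt_of_pow_lt_pow_left₀ 2 (by positivity) (h2.trans_lt hn)
  have hm : Measurable fun x : S.V n → X => (Fintype.card (S.V n) : ℝ)⁻¹ *
        ∑ v, f (pullbackName (S.σ n) v x) * g v :=
    (Finset.measurable_sum _ fun v _ => (hπ v).mul_const _).const_mul _
  have hb : ∀ x : S.V n → X, |(Fintype.card (S.V n) : ℝ)⁻¹ *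
      ∑ v, f (pullbackName (S.σ n) v x) * g v| ≤ ‖f‖ * C := fun x => abs_average_le fun v => by
    rw [abs_mul]
    exact mul_le_mul (f.norm_coe_le_norm _) (hg v) (abs_nonneg _) (norm_nonneg _)
  have h4 := mul_meas_ge_le_integral_of_nonneg (μ := (μs n : Measure (S.V n → X)))
    (f := fun x => ((Fintype.card (S.V n) : ℝ)⁻¹ *
        ∑ v, f (pullbackName (S.σ n) v x) * g v) ^ 2) (Eventually.of_forall fun x => sq_nonneg _)
    (integrable_of_bounded (hm.pow_const 2) (B := (‖f‖ * C) ^ 2) fun x => by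
      rw [abs_pow]; exact pow_le_pow_left₀ (abs_nonneg _) (hb x) 2) (η ^ 2)
  have h5 : {x : S.V n → X | η ^ 2 ≤ ((Fintype.card (S.V n) : ℝ)⁻¹ *
        ∑ v, f (pullbackName (S.σ n) v x) * g v) ^ 2} = {x | η ≤ |(Fintype.card (S.V n) : ℝ)⁻¹ *
        ∑ v, f (pullbackName (S.σ n) v x) * g v|} := by
    ext x
    rw [Set.mem_ofPred_eq, Set.mem_ofPred_eq, ← sq_abs (_ * _),
      pow_le_pow_iff_left₀ hη.le (abs_nonneg _) two_ne_zero]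
  rw [h5] at h4
  exact lt_of_mul_lt_mul_left (h4.trans_lt h3) (by positivity)

/-- If `μs` doubly-quenched converges to `μ`, then every good model of `ν` pairs with most samples
of `μs` to a good model of the product. -/
theorem exists_nhds_eventually_real_lt {S : SoficApprox.{u, w} G}
    {μs : ∀ n, ProbabilityMeasure (S.V n → X)} {μ : ProbabilityMeasure (G → X)}
    (hμ : DoublyQuenchedTendsto S μs μ) (ν : ProbabilityMeasure (G → Y))
    {O : Set (ProbabilityMeasure (G → X × Y))} (hO : O ∈ 𝓝 (joining μ ν)) {ε : ℝ} (hε : 0 < ε) :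
    ∃ U ∈ 𝓝 ν, ∀ᶠ n in atTop, ∀ y ∈ goodModels U (S.σ n),
      (μs n : Measure (S.V n → X)).real {x | (fun v => (x v, y v)) ∈ goodModels O (S.σ n)}ᶜ < ε := by
  -- The sets `O` satisfying the conclusion for every `ε` form a filter, so the claim becomes
  -- convergence of the identity along `𝓕` and need only be tested on products `f ⊗ g`.
  let 𝓕 : Filter (ProbabilityMeasure (G → X × Y)) :=
    { sets := {O | ∀ ε > 0, ∃ U ∈ 𝓝 ν, ∀ᶠ n in atTop, ∀ y ∈ goodModels U (S.σ n),
        (μs n : Measure (S.V n → X)).real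
          {x | (fun v => (x v, y v)) ∈ goodModels O (S.σ n)}ᶜ < ε}
      univ_sets := fun ε hε => ⟨Set.univ, univ_mem,
        Eventually.of_forall fun n y _ => by simpa [goodModels] using hε⟩
      sets_of_superset := fun {O O'} h hOO' ε hε => by
        obtain ⟨U, hU, h⟩ := h ε hε
        refine ⟨U, hU, h.mono fun n hn y hy => (measureReal_mono ?_).trans_lt (hn y hy)⟩
        exact Set.compl_subset_compl.2 fun x hx => hOO' hx
      inter_sets := fun {O O'} h h' ε hε => by
        obtain ⟨U, hU, h⟩ := h (ε / 2) (by positivity)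
        obtain ⟨U', hU', h'⟩ := h' (ε / 2) (by positivity)
        refine ⟨U ∩ U', inter_mem hU hU', ?_⟩
        filter_upwards [h, h'] with n hn hn' y hy
        have e : {x : S.V n → X | (fun v => (x v, y v)) ∈ goodModels (O ∩ O') (S.σ n)}ᶜ =
            {x : S.V n → X | (fun v => (x v, y v)) ∈ goodModels O (S.σ n)}ᶜ ∪
            {x : S.V n → X | (fun v => (x v, y v)) ∈ goodModels O' (S.σ n)}ᶜ := by
          rw [← Set.compl_inter]; rfl
        rw [e]
        refine (measureReal_union_le _ _).trans_lt ?_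
        linarith [hn y hy.1, hn' y hy.2] }
  suffices h : Tendsto id 𝓕 (𝓝 (joining μ ν)) from h hO ε hε
  let M : Submonoid C(G → X × Y, ℝ) :=
    { carrier := {h | ∃ (f : C(G → X, ℝ)) (g : C(G → Y, ℝ)),
        ∀ z, h z = f (fun i => (z i).1) * g (fun i => (z i).2)}
      one_mem' := ⟨1, 1, by simp⟩
      mul_mem' := by
        rintro h h' ⟨f, g, hfg⟩ ⟨f', g', hfg'⟩
        refine ⟨f * f', g * g', fun z => ?_⟩
        simp only [ContinuousMap.mul_apply, hfg, hfg']
        ring }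
  refine tendsto_of_submonoid M ?_ ?_
  · intro x y hxy
    obtain ⟨g, hg⟩ := Function.ne_iff.1 hxy
    by_cases h1 : (x g).1 = (y g).1
    · have h2 : (x g).2 ≠ (y g).2 := fun h2 => hg (Prod.ext h1 h2)
      refine ⟨⟨fun z => dist (z g).2 (x g).2, by fun_prop⟩,
        ⟨1, ⟨fun z => dist (z g) (x g).2, by fun_prop⟩, by simp⟩, ?_⟩
      simpa using fun h => h2 h.symm
    · refine ⟨⟨fun z => dist (z g).1 (x g).1, by fun_prop⟩,
        ⟨⟨fun z => dist (z g) (x g).1, by fun_prop⟩, 1, by simp⟩, ?_⟩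
      simpa using fun h => h1 h.symm
  · rintro h ⟨f, g, hfg⟩
    rw [Metric.tendsto_nhds]
    intro η hη ε hε
    set m := ∫ x, f x ∂(μ : Measure (G → X)) with hm
    let f₀ : C(G → X, ℝ) := f - ContinuousMap.const _ m
    have hf₀ : ∫ x, f₀ x ∂(μ : Measure (G → X)) = 0 := by
      have : ∀ x, f₀ x = f x - m := fun x => rfl
      simp_rw [this]
      rw [integral_sub (integrable_continuousMap μ f) (integrable_const _)]
      simp [hm]
    have hint : ∫ z, h z ∂(joining μ ν : Measure (G → X × Y)) =
        m * ∫ y, g y ∂(ν : Measure (G → Y)) := by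
      simp_rw [hfg]
      exact integral_joining_mul μ ν f.continuous.measurable g.continuous.measurable
    -- Writing `f = f₀ + m`, the `f₀` part concentrates by choice of `x`, and the part `m` times the
    -- average of `g` is controlled by the goodness of `y`. The `+ 1` covers `m = 0`.
    refine ⟨_, eventually_abs_integral_sub_lt ν g (ε := η / (2 * (|m| + 1))) (by positivity), ?_⟩
    filter_upwards [eventually_forall_weights_real_lt hμ f₀ hf₀ ‖g‖ (half_pos hη) hε] with n hn y hy
    refine (measureReal_mono ?_).trans_lt (hn (fun v => g (pullbackName (S.σ n) v y))
      fun v => g.norm_coe_le_norm _)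
    intro x hx
    by_contra hcon
    refine hx ?_
    rw [Set.mem_ofPred_eq, not_le] at hcon
    simp only [goodModels, Set.mem_ofPred_eq, id, Real.dist_eq] at hy ⊢
    rw [hint, integral_empirical _ _ h.continuous.measurable.stronglyMeasurable]
    rw [integral_empirical _ _ g.continuous.measurable.stronglyMeasurable] at hy
    have hsplit : (Fintype.card (S.V n) : ℝ)⁻¹ *
        ∑ v, h (pullbackName (S.σ n) v fun v => (x v, y v)) =
        (Fintype.card (S.V n) : ℝ)⁻¹ *
          ∑ v, f₀ (pullbackName (S.σ n) v x) * g (pullbackName (S.σ n) v y) +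
        m * ((Fintype.card (S.V n) : ℝ)⁻¹ * ∑ v, g (pullbackName (S.σ n) v y)) := by
      rw [mul_left_comm m, ← mul_add, Finset.mul_sum _ _ m, ← Finset.sum_add_distrib]
      congr 1
      refine Finset.sum_congr rfl fun v _ => ?_
      rw [hfg]
      change f (pullbackName (S.σ n) v x) * g (pullbackName (S.σ n) v y) =
        (f (pullbackName (S.σ n) v x) - m) * _ + _
      ring
    rw [hsplit, add_sub_assoc, ← mul_sub]
    refine (abs_add_le _ _).trans_lt ?_
    rw [abs_mul m]
    have h6 : |m| * |(Fintype.card (S.V n) : ℝ)⁻¹ * ∑ v, g (pullbackName (S.σ n) v y) -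
        ∫ y, g y ∂(ν : Measure (G → Y))| ≤ η / 2 := by
      have := mul_le_mul (show |m| ≤ |m| + 1 by linarith) hy.le (abs_nonneg _) (by positivity)
      refine this.trans_eq ?_
      field_simp
    linarith

end DoublyQuenched

/-! ### Superadditivity for products. -/

section Lower

theorem hammingAvg_fst_le {V X Y : Type*} [Fintype V] [MetricSpace X] [MetricSpace Y]
    (x y : V → X × Y) : hammingAvg (fun v => (x v).1) (fun v => (y v).1) ≤ hammingAvg x y := by
  simp only [hammingAvg]
  gcongr
  exact le_max_left _ _

theorem hammingAvg_snd_le {V X Y : Type*} [Fintype V] [MetricSpace X] [MetricSpace Y]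
    (x y : V → X × Y) : hammingAvg (fun v => (x v).2) (fun v => (y v).2) ≤ hammingAvg x y := by
  simp only [hammingAvg]
  gcongr
  exact le_max_right _ _

/-- If every section of `A` over `B` has almost full measure, then a cover of `A` is at least the
size of a cover of `B` times the size of a cover of the measure. -/
theorem cov_mul_measureCov_le {V X Y : Type*} [Fintype V] [MetricSpace X] [MetricSpace Y]
    [MeasurableSpace X] {θ : ProbabilityMeasure (V → X)} {A : Set (V → X × Y)} {B : Set (V → Y)}
    {δ δ' ε : ℝ} (hδ' : 0 < δ') (hδ : 2 * δ ≤ δ')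
    (h : ∀ y ∈ B, 1 - ε < (θ : Measure (V → X)).real {x | (fun v => (x v, y v)) ∈ A}) :
    cov δ' B * measureCov ε δ θ ≤ cov δ A := by
  classical
  obtain ⟨E, hEB, hBE, hE⟩ := exists_maximal_separated hδ' B
  refine le_iInf₂ fun F _ => le_iInf fun hAF => ?_
  have hcov : cov δ' B ≤ E.encard := iInf₂_le_of_le E hEB (iInf_le_of_le hBE le_rfl)
  refine (mul_le_mul_left hcov _).trans ?_
  -- `p` sends a centre to the point of `E` near its second coordinate, unique since `E` is
  -- `δ'`-separated and `2 * δ ≤ δ'`; the fallback value plays no role.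
  let p : (V → X × Y) → (V → Y) := fun f =>
    if hf : ∃ y ∈ E, hammingAvg y (fun v => (f v).2) < δ then hf.choose else fun v => (f v).2
  have hp : ∀ y ∈ E, ∀ f, hammingAvg y (fun v => (f v).2) < δ → p f = y := by
    intro y hy f hyf
    have hf : ∃ y ∈ E, hammingAvg y (fun v => (f v).2) < δ := ⟨y, hy, hyf⟩
    simp only [p, dif_pos hf]
    obtain ⟨h1, h2⟩ := hf.choose_spec
    refine hE _ h1 _ hy ?_
    have := hammingAvg_triangle hf.choose (fun v => (f v).2) y
    rw [hammingAvg_comm (fun v => (f v).2) y] at this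
    linarith
  refine encard_mul_le_of_fibers p fun y hy => ?_
  -- The first coordinates of the fibre over `y` form a `δ`-net of the section of `A` at `y`, which
  -- has measure above `1 - ε`.
  refine (iInf₂_le_of_le ((fun f v => (f v).1) '' {f ∈ F | p f = y}) ?_ le_rfl).trans
    (Set.encard_image_le _ _)
  refine (h y (hEB hy)).trans_le (measureReal_mono fun x hx => ?_)
  obtain ⟨f, hf, hxf⟩ := hAF hx
  exact ⟨_, ⟨f, ⟨hf, hp y hy f ((hammingAvg_snd_le _ _).trans_lt hxf)⟩, rfl⟩,
    (hammingAvg_fst_le _ _).trans_lt hxf⟩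

variable {G : Type u} [Group G] [Countable G]
  {X : Type*} [MetricSpace X] [CompactSpace X] [MeasurableSpace X] [BorelSpace X]
  {Y : Type*} [MetricSpace Y] [CompactSpace Y] [MeasurableSpace Y] [BorelSpace Y]

/-- Superadditivity of sofic entropy under products, with doubly-quenched model-measure entropy
in one factor and lower sofic entropy in the other. -/
theorem add_le_processEntropy_joining (S : SoficApprox.{u, w} G) (μ : ProbabilityMeasure (G → X))
    (ν : ProbabilityMeasure (G → Y)) :
    processDQEntropy S μ + processLowerEntropy S ν ≤ processEntropy S (joining μ ν) := by
  refine EReal.add_le_of_forall_lt fun a ha b hb => ?_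
  simp only [processDQEntropy, lt_iSup_iff] at ha
  obtain ⟨φ, hφ, μs, hμs, δ, hδ, ε, hε, ha⟩ := ha
  simp only [processLowerEntropy, lt_iSup_iff] at hb
  obtain ⟨δ', hδ', hb⟩ := hb
  -- One radius for both demands: at most `δ` for the measure cover, at most `δ' / 2` for the
  -- separation.
  set δ₀ := min δ (δ' / 2) with hδ₀
  have hδ₀pos : 0 < δ₀ := lt_min hδ (by positivity)
  refine le_iSup₂_of_le δ₀ hδ₀pos (le_iInf₂ fun O hO => ?_)
  obtain ⟨U, hU, hUO⟩ := exists_nhds_eventually_real_lt hμs ν hO hε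
  have hb' := hφ.tendsto_atTop.eventually
    (eventually_lt_of_lt_liminf (hb.trans_le (iInf₂_le U hU)))
  -- The first bound holds only for infinitely many `i`. The second must hold for all large `i` to
  -- meet it, which is why a liminf is taken in the second factor.
  have ha' := frequently_lt_of_lt_limsup isCobounded_le_of_bot ha
  refine le_limsup_of_frequently_le ?_ isBounded_le_of_top
  refine hφ.tendsto_atTop.frequently ((ha'.and_eventually (hb'.and hUO)).mono ?_)
  rintro i ⟨h1, h2, h3⟩
  let θ : ProbabilityMeasure (S.V (φ i) → X) := μs i
  have hsec : ∀ y ∈ goodModels U (S.σ (φ i)), 1 - ε < (θ : Measure (S.V (φ i) → X)).real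
      {x | (fun v => (x v, y v)) ∈ goodModels O (S.σ (φ i))} := by
    intro y hy
    have h4 : _ < ε := h3 y hy
    have h5 := measureReal_union_le (μ := (θ : Measure (S.V (φ i) → X)))
      {x : S.V (φ i) → X | (fun v => (x v, y v)) ∈ goodModels O (S.σ (φ i))}
      {x : S.V (φ i) → X | (fun v => (x v, y v)) ∈ goodModels O (S.σ (φ i))}ᶜ
    rw [Set.union_compl_self, probReal_univ] at h5
    change (θ : Measure (S.V (φ i) → X)).real
      {x : S.V (φ i) → X | (fun v => (x v, y v)) ∈ goodModels O (S.σ (φ i))}ᶜ < ε at h4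
    linarith
  calc a + b ≤ rate (S.V (φ i)) (measureCov ε δ (θ)) +
        rate (S.V (φ i)) (cov δ' (goodModels U (S.σ (φ i)))) := add_le_add h1.le h2.le
    _ = rate (S.V (φ i)) (cov δ' (goodModels U (S.σ (φ i))) * measureCov ε δ (θ)) := by
      rw [rate_mul, add_comm]
    _ ≤ rate (S.V (φ i)) (cov δ₀ (goodModels O (S.σ (φ i)))) := by
      refine rate_mono (le_trans ?_ (cov_mul_measureCov_le (θ := θ) hδ'
        (by linarith [min_le_right δ (δ' / 2)]) hsec))
      exact mul_le_mul_right (measureCov_anti (min_le_left _ _) _ _) _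

end Lower

/-! ### Measurable codings: Lusin sets and moduli of continuity. -/

section Lusin

variable {X Y : Type*} [MetricSpace X] [CompactSpace X] [MeasurableSpace X] [BorelSpace X]
  [MetricSpace Y] [CompactSpace Y] [MeasurableSpace Y] [BorelSpace Y]

/-- **Lusin's theorem** for measurable maps between compact metric spaces. -/
theorem exists_isCompact_continuousOn (ρ : Measure X) [IsProbabilityMeasure ρ] {φ : X → Y}
    (hφ : Measurable φ) {η : ℝ} (hη : 0 < η) :
    ∃ K : Set X, IsCompact K ∧ ContinuousOn φ K ∧ ρ.real Kᶜ ≤ η := by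
  have hm : Measurable fun x => (x, φ x) := measurable_id.prodMk hφ
  have : IsProbabilityMeasure (ρ.map fun x => (x, φ x)) :=
    Measure.isProbabilityMeasure_map hm.aemeasurable
  have hΓ : MeasurableSet {p : X × Y | φ p.1 = p.2} :=
    measurableSet_eq_fun (hφ.comp measurable_fst) measurable_snd
  -- Inner regularity of the law on the graph of `φ`: over the projection of a compact piece `C` of
  -- the graph, preimages of closed sets are projections of compact sets, so `φ` is continuous
  -- there.
  obtain ⟨C, hCΓ, hC, hlt⟩ := hΓ.exists_isCompact_lt_add (μ := ρ.map fun x => (x, φ x))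
    (measure_ne_top _ _) (ε := ENNReal.ofReal η) (by simpa using hη)
  have hKc : IsCompact (Prod.fst '' C) := hC.image continuous_fst
  refine ⟨Prod.fst '' C, hKc, ?_, ?_⟩
  · rw [continuousOn_iff_isClosed]
    intro t ht
    refine ⟨Prod.fst '' (C ∩ Prod.snd ⁻¹' t),
      ((hC.inter_right (ht.preimage continuous_snd)).image continuous_fst).isClosed, ?_⟩
    ext x
    constructor
    · rintro ⟨hx, p, hp, rfl⟩
      exact ⟨⟨p, ⟨hp, by rw [Set.mem_preimage, ← hCΓ hp]; exact hx⟩, rfl⟩, p, hp, rfl⟩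
    · rintro ⟨⟨p, ⟨hp, hpt⟩, rfl⟩, hK⟩
      exact ⟨by rw [Set.mem_preimage, hCΓ hp]; exact hpt, hK⟩
  · rw [Measure.map_apply hm hΓ, Measure.map_apply hm hC.measurableSet] at hlt
    have h1 : ρ ((fun x => (x, φ x)) ⁻¹' {p : X × Y | φ p.1 = p.2}) = 1 := by
      rw [← measure_univ (μ := ρ)]; congr 1; ext; simp
    have h2 : ρ ((fun x => (x, φ x)) ⁻¹' C) ≤ ρ (Prod.fst '' C) :=
      measure_mono fun x hx => ⟨_, hx, rfl⟩
    rw [h1] at hlt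
    have h3 : (1 : ℝ≥0∞) ≤ ρ (Prod.fst '' C) + ENNReal.ofReal η := hlt.le.trans (by gcongr)
    rw [probReal_compl_eq_one_sub hKc.measurableSet, Measure.real]
    have h4 := ENNReal.toReal_mono (by finiteness) h3
    rw [ENNReal.toReal_add (by finiteness) (by finiteness), ENNReal.toReal_ofReal hη.le] at h4
    simp at h4
    linarith

end Lusin

/-- Beyond the scale of uniform continuity the crude bound `2 * ‖f‖` is absorbed by the linear term.
An affine modulus is wanted because it can be averaged over vertices. -/
theorem exists_modulus {Y : Type*} [MetricSpace Y] [CompactSpace Y] (f : C(Y, ℝ)) {e : ℝ}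
    (he : 0 < e) :
    ∃ C : ℝ, 0 ≤ C ∧ ∀ a b, |f a - f b| ≤ e + C * dist a b := by
  obtain ⟨s, hs, h⟩ := Metric.uniformContinuous_iff.1
    (CompactSpace.uniformContinuous_of_continuous f.continuous) e he
  refine ⟨2 * ‖f‖ / s, by positivity, fun a b => ?_⟩
  rcases lt_or_ge (dist a b) s with hab | hab
  · have := (h hab).le
    rw [Real.dist_eq] at this
    exact this.trans (le_add_of_nonneg_right (by positivity))
  · have h1 : |f a - f b| ≤ 2 * ‖f‖ := by
      have := abs_sub (f a) (f b)
      have ha := f.norm_coe_le_norm a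
      have hb := f.norm_coe_le_norm b
      rw [Real.norm_eq_abs] at ha hb
      linarith
    have h2 : 2 * ‖f‖ ≤ 2 * ‖f‖ / s * dist a b := by
      rw [div_mul_eq_mul_div, le_div_iff₀ hs]
      gcongr
    linarith

theorem integral_apply_eq {G X : Type*} [MeasurableSpace X] {μ : ProbabilityMeasure (G → X)}
    {ρ : Measure X} {g : G} (hρ : Measure.map (fun z => z g) (μ : Measure (G → X)) = ρ)
    {u : X → ℝ} (hu : Measurable u) : ∫ z, u (z g) ∂(μ : Measure (G → X)) = ∫ x, u x ∂ρ := by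
  rw [← hρ, integral_map (measurable_pi_apply g).aemeasurable hu.aestronglyMeasurable]

theorem integral_le_mul_real_compl {X : Type*} [TopologicalSpace X] [MeasurableSpace X]
    [BorelSpace X] {ρ : Measure X} [IsProbabilityMeasure ρ] {K : Set X} (hK : IsClosed K)
    {u : X → ℝ} (hu : Measurable u) {D : ℝ} (h0 : ∀ x, 0 ≤ u x) (hD : ∀ x, u x ≤ D)
    (hu0 : ∀ x ∈ K, u x = 0) : ∫ x, u x ∂ρ ≤ D * ρ.real Kᶜ := by
  have hi : Integrable (Kᶜ.indicator fun _ => D) ρ :=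
    (integrable_const D).indicator hK.measurableSet.compl
  refine (integral_mono (integrable_of_bounded hu (B := D) fun x => by
    rw [abs_of_nonneg (h0 x)]; exact hD x) hi fun x => ?_).trans_eq ?_
  · by_cases hx : x ∈ K
    · simp [hx, hu0 x hx]
    · have : x ∈ Kᶜ := hx
      simpa [Set.indicator_of_mem this] using hD x
  · rw [integral_indicator hK.measurableSet.compl]
    simp [mul_comm]

/-! ### Moving good models into a Lusin set. -/

section Retraction

variable {G : Type u} [Countable G] {X : Type*} [MetricSpace X] [CompactSpace X]
  [MeasurableSpace X] [BorelSpace X] {Y : Type*} [TopologicalSpace Y]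

/-- The property `p` holds for all good enough models `x` of `μ` and all nearest-point projections
`x'` of `x` to a large enough compact set on which `φ` is continuous. -/
def ForRetracts (φ : X → Y) (μ : ProbabilityMeasure (G → X)) (ρ : Measure X)
    (p : ∀ (V : Type w) [Fintype V] [Nonempty V], (G → Equiv.Perm V) → (V → X) → (V → X) → Prop) :
    Prop :=
  ∃ η > 0, ∀ K : Set X, IsCompact K → K.Nonempty → ContinuousOn φ K → ρ.real Kᶜ ≤ η →
    ∃ O ∈ 𝓝 μ, ∀ (V : Type w) [Fintype V] [Nonempty V] (σ : G → Equiv.Perm V) (x x' : V → X),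
      empirical σ x ∈ O → (∀ v, x' v ∈ K ∧ dist (x v) (x' v) = Metric.infDist (x v) K) → p V σ x x'

variable {φ : X → Y} {μ : ProbabilityMeasure (G → X)} {ρ : Measure X}
  {p q : ∀ (V : Type w) [Fintype V] [Nonempty V], (G → Equiv.Perm V) → (V → X) → (V → X) → Prop}

/-- Because `η` is chosen before `K`, two properties can share one compact set. This also yields the
intersection axiom of a filter. -/
theorem ForRetracts.and (hp : ForRetracts φ μ ρ p) (hq : ForRetracts φ μ ρ q) :
    ForRetracts φ μ ρ fun V _ _ σ x x' => p V σ x x' ∧ q V σ x x' := by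
  obtain ⟨η, hη, h⟩ := hp
  obtain ⟨η', hη', h'⟩ := hq
  refine ⟨min η η', lt_min hη hη', fun K hK hne hφ hρ => ?_⟩
  obtain ⟨O, hO, h⟩ := h K hK hne hφ (hρ.trans (min_le_left _ _))
  obtain ⟨O', hO', h'⟩ := h' K hK hne hφ (hρ.trans (min_le_right _ _))
  exact ⟨O ∩ O', inter_mem hO hO', fun V _ _ σ x x' hx hx' =>
    ⟨h V σ x x' hx.1 hx', h' V σ x x' hx.2 hx'⟩⟩

theorem ForRetracts.mono (hp : ForRetracts φ μ ρ p)
    (hpq : ∀ (V : Type w) [Fintype V] [Nonempty V] (σ : G → Equiv.Perm V) (x x' : V → X),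
      p V σ x x' → q V σ x x') : ForRetracts φ μ ρ q := by
  obtain ⟨η, hη, h⟩ := hp
  refine ⟨η, hη, fun K hK hne hφ hρ => ?_⟩
  obtain ⟨O, hO, h⟩ := h K hK hne hφ hρ
  exact ⟨O, hO, fun V _ _ σ x x' hx hx' => hpq V σ x x' (h V σ x x' hx hx')⟩

variable [Group G]

/-- For a continuous function `u` of one coordinate, averages along good models are close to the
integral. -/
theorem eventually_average_lt (hρ : ∀ g, Measure.map (fun z => z g) (μ : Measure (G → X)) = ρ)
    {u : X → ℝ} (hu : Continuous u) {c : ℝ} (hc : ∫ x, u x ∂ρ < c) :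
    ∃ O ∈ 𝓝 μ, ∀ (V : Type w) [Fintype V] [Nonempty V] (σ : G → Equiv.Perm V) (x : V → X),
      empirical σ x ∈ O → (Fintype.card V : ℝ)⁻¹ * ∑ v, u (x v) < c := by
  let U : C(G → X, ℝ) := ⟨fun z => u (z 1), by fun_prop⟩
  refine ⟨_, eventually_abs_integral_sub_lt μ U (sub_pos.2 hc), fun V _ _ σ x hx => ?_⟩
  rw [Set.mem_ofPred_eq, integral_empirical _ _ U.continuous.measurable.stronglyMeasurable] at hx
  have h1 : ∫ z, U z ∂(μ : Measure (G → X)) = ∫ x, u x ∂ρ := integral_apply_eq (hρ 1) hu.measurable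
  have h2 : ∑ v, U (pullbackName σ v x) = ∑ v, u (x v) := sum_pullbackName σ x 1 u
  rw [h1, h2] at hx
  linarith [(abs_lt.1 hx).2]

/-- The distance moved is `Metric.infDist · K`, a continuous one-letter function with integral at
most the diameter times `ρ.real Kᶜ`, and good models nearly reproduce that integral. -/
theorem forRetracts_hammingAvg_lt [IsProbabilityMeasure ρ]
    (hρ : ∀ g, Measure.map (fun z => z g) (μ : Measure (G → X)) = ρ) {ε : ℝ} (hε : 0 < ε) :
    ForRetracts.{u, w} φ μ ρ fun _ _ _ _ x x' => hammingAvg x x' < ε := by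
  set D := Metric.diam (Set.univ : Set X)
  have hD : 0 ≤ D := Metric.diam_nonneg
  refine ⟨ε / (2 * (D + 1)), by positivity, fun K hK ⟨k, hk⟩ _ hη => ?_⟩
  have hint : ∫ x, Metric.infDist x K ∂ρ < ε := by
    refine (integral_le_mul_real_compl hK.isClosed (Metric.continuous_infDist_pt K).measurable
      (fun x => Metric.infDist_nonneg) (D := D) (fun x => ?_)
      fun x hx => Metric.infDist_zero_of_mem hx).trans_lt ?_
    · exact (Metric.infDist_le_dist_of_mem hk).trans
        (Metric.dist_le_diam_of_mem isCompact_univ.isBounded trivial trivial)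
    · refine (mul_le_mul_of_nonneg_left hη hD).trans_lt ?_
      rw [mul_div_assoc', div_lt_iff₀ (by positivity)]
      nlinarith
  obtain ⟨O, hO, h⟩ := eventually_average_lt.{u, w} hρ (Metric.continuous_infDist_pt K) hint
  refine ⟨O, hO, fun V _ _ σ x x' hx hx' => ?_⟩
  simp only [hammingAvg, (hx' _).2]
  exact h V σ x hx

/-- Averages of a local function that is continuous along with `φ`. -/
theorem forRetracts_abs_average_sub_lt [IsProbabilityMeasure ρ]
    (hρ : ∀ g, Measure.map (fun z => z g) (μ : Measure (G → X)) = ρ)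
    (F : Finset G) {h : (F → X) → ℝ} (hm : Measurable h) {M : ℝ} (hM : ∀ y, |h y| ≤ M)
    (hc : ∀ K, ContinuousOn φ K → ContinuousOn h {y | ∀ g, y g ∈ K}) {ε : ℝ} (hε : 0 < ε) :
    ForRetracts.{u, w} φ μ ρ fun V _ _ σ _ x' =>
      |(Fintype.card V : ℝ)⁻¹ * ∑ v, h (fun g => pullbackName σ v x' g) -
        ∫ z, h (fun g => z g) ∂(μ : Measure (G → X))| < ε := by
  have hM0 : 0 ≤ M := by
    obtain ⟨x⟩ := ρ.nonempty_of_neZero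
    exact (abs_nonneg _).trans (hM fun _ => x)
  set m : ℝ := (F.card : ℝ)
  set η : ℝ := ε / (12 * (M + 1) * (m + 1)) with hη
  have hηpos : 0 < η := by positivity
  have hη6 : 6 * M * m * η ≤ ε / 2 := by
    rw [hη, mul_div_assoc', div_le_div_iff₀ (by positivity) (by positivity)]
    have : 0 ≤ ε * (M + m + 1) := by positivity
    nlinarith
  refine ⟨η, hηpos, fun K hK hne hφ hη' => ?_⟩
  have hCc : IsClosed {y : F → X | ∀ g, y g ∈ K} := by
    simp only [Set.ofPred_forall]
    exact isClosed_iInter fun g => hK.isClosed.preimage (continuous_apply g)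
  -- Tietze: extending `h` from `K`-valued configurations, with the same bound, gives a genuine
  -- weak-* test function `H`.
  obtain ⟨h', hh'M, hh'⟩ := ContinuousMap.exists_restrict_eq_forall_mem_of_closed
    (t := Set.Icc (-M) M) ⟨_, (hc K hφ).domRestrict⟩ (fun y => abs_le.1 (hM _))
    ⟨0, by simpa using hM0, by simpa using hM0⟩ hCc
  have hh'eq : ∀ y : F → X, (∀ g, y g ∈ K) → h' y = h y := fun y hy =>
    congrArg (fun f => f ⟨y, hy⟩) hh'
  have hh'M' : ∀ y, |h' y| ≤ M := fun y => abs_le.2 (hh'M y)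
  let H : C(G → X, ℝ) := ⟨fun z => h' fun g => z g, by fun_prop⟩
  obtain ⟨κ, hκ, huc⟩ := Metric.uniformContinuous_iff.1
    (CompactSpace.uniformContinuous_of_continuous h'.continuous) (ε / 4) (by positivity)
  -- A continuous majorant of the indicator of letters moved by at least `κ`, used to bound the
  -- proportion of such vertices.
  let u : X → ℝ := fun x => min 1 (Metric.infDist x K / κ)
  have hu : Continuous u :=
    continuous_const.min ((Metric.continuous_infDist_pt K).div_const κ)
  have hu0 : ∀ x, 0 ≤ u x := fun x => le_min zero_le_one (div_nonneg Metric.infDist_nonneg hκ.le)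
  have huint : ∫ x, u x ∂ρ < 2 * η := by
    refine (integral_le_mul_real_compl hK.isClosed hu.measurable hu0 (D := 1)
      (fun x => min_le_left _ _) fun x hx => ?_).trans_lt (by linarith)
    simp [u, Metric.infDist_zero_of_mem hx]
  obtain ⟨O, hO, hOu⟩ := eventually_average_lt.{u, w} hρ hu huint
  refine ⟨_, inter_mem hO (eventually_abs_integral_sub_lt μ H (show 0 < ε / 4 by positivity)),
    fun V _ _ σ x x' hx hx' => ?_⟩
  have hcard : (0 : ℝ) < Fintype.card V := by exact_mod_cast Fintype.card_pos
  have h1 := hOu V σ x hx.1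
  have h2 := hx.2
  rw [Set.mem_ofPred_eq, integral_empirical _ _ H.continuous.measurable.stronglyMeasurable] at h2
  -- `H` and `h` differ only when one of the `m` coordinates leaves `K`, and then by at most `2 *
  -- M`.
  have h3 : |∫ z, H z ∂(μ : Measure (G → X)) - ∫ z, h (fun g => z g) ∂(μ : Measure (G → X))| ≤
      2 * M * m * η := by
    have hmh : Measurable fun z : G → X => h fun g => z g := hm.comp (by fun_prop)
    have hi : Integrable (fun z : G → X => h fun g => z g) (μ : Measure (G → X)) :=
      integrable_of_bounded hmh fun z => hM _
    let s : Set (G → X) := ⋃ g ∈ F, (fun z => z g) ⁻¹' Kᶜ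
    have hs : MeasurableSet s := Finset.measurableSet_biUnion _ fun g _ =>
      (measurable_pi_apply g) hK.measurableSet.compl
    have hsm : (μ : Measure (G → X)).real s ≤ m * η := by
      refine (measureReal_biUnion_finset_le _ _).trans ?_
      refine (Finset.sum_le_card_nsmul _ _ η fun g _ => ?_).trans_eq (nsmul_eq_mul _ _)
      rw [← map_measureReal_apply (measurable_pi_apply g) hK.measurableSet.compl, hρ]
      exact hη'
    rw [← integral_sub (integrable_continuousMap μ H) hi]
    calc |∫ z, (H z - h fun g => z g) ∂(μ : Measure (G → X))|
        ≤ ∫ z, |H z - h fun g => z g| ∂(μ : Measure (G → X)) := abs_integral_le_integral_abs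
      _ ≤ ∫ z, s.indicator (fun _ => 2 * M) z ∂(μ : Measure (G → X)) := by
        refine integral_mono ((integrable_continuousMap μ H).sub hi).abs
          ((integrable_const _).indicator hs) fun z => ?_
        by_cases hz : z ∈ s
        · simp only [Set.indicator_of_mem hz]
          have a1 := hM fun g => z g
          have a2 : |H z| ≤ M := hh'M' _
          have := abs_sub (H z) (h fun g => z g)
          linarith
        · have hz' : ∀ g : F, z g ∈ K := by
            simpa [s] using hz
          have : H z = h fun g => z g := hh'eq _ hz'
          simp [hz, this]
      _ = 2 * M * (μ : Measure (G → X)).real s := by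
        rw [integral_indicator hs]; simp [mul_comm]
      _ ≤ 2 * M * m * η := by
        rw [mul_assoc (2 * M)]; gcongr
  -- Uniform continuity costs `ε / 4`, and vertices with a far-moved coordinate cost `2 * M` each.
  -- With `h3` these exceptional errors total `6 * M * m * η ≤ ε / 2`.
  have h4 : |(Fintype.card V : ℝ)⁻¹ * ∑ v, h (fun g => pullbackName σ v x' g) -
      (Fintype.card V : ℝ)⁻¹ * ∑ v, H (pullbackName σ v x)| ≤ ε / 4 + 2 * M * m * (2 * η) := by
    rw [← mul_sub, ← Finset.sum_sub_distrib, abs_mul, abs_of_pos (inv_pos.2 hcard)]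
    have hpt : ∀ v, |h (fun g => pullbackName σ v x' g) - H (pullbackName σ v x)| ≤
        ε / 4 + 2 * M * ∑ g ∈ F, u (pullbackName σ v x g) := by
      intro v
      rw [← hh'eq (fun g => pullbackName σ v x' g) fun g => (hx' (σ g v)).1]
      change |h' (fun g => pullbackName σ v x' g) - h' (fun g => pullbackName σ v x g)| ≤ _
      have hsum0 : 0 ≤ ∑ g ∈ F, u (pullbackName σ v x g) := Finset.sum_nonneg fun g _ => hu0 _
      by_cases hall : ∀ g : F, dist (pullbackName σ v x' g) (pullbackName σ v x g) < κ
      · have := (huc ((dist_pi_lt_iff hκ).2 hall)).le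
        rw [Real.dist_eq] at this
        exact this.trans (le_add_of_nonneg_right (by positivity))
      · push Not at hall
        obtain ⟨g, hg⟩ := hall
        have hu1 : u (pullbackName σ v x g) = 1 := by
          refine min_eq_left ?_
          rw [le_div_iff₀ hκ, one_mul]
          change κ ≤ Metric.infDist (x (σ g v)) K
          rw [← (hx' (σ g v)).2, dist_comm]
          exact hg
        have h5 : 1 ≤ ∑ g ∈ F, u (pullbackName σ v x g) := by
          rw [← hu1]
          exact Finset.single_le_sum (f := fun g => u (pullbackName σ v x g)) (fun g _ => hu0 _) g.2
        have h6 := abs_sub (h' (fun g => pullbackName σ v x' g))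
          (h' (fun g => pullbackName σ v x g))
        have h7 := hh'M' (fun g => pullbackName σ v x' g)
        have h8 := hh'M' (fun g => pullbackName σ v x g)
        nlinarith
    calc (Fintype.card V : ℝ)⁻¹ *
          |∑ v, (h (fun g => pullbackName σ v x' g) - H (pullbackName σ v x))|
        ≤ (Fintype.card V : ℝ)⁻¹ * ∑ v, (ε / 4 + 2 * M * ∑ g ∈ F, u (pullbackName σ v x g)) := by
          gcongr
          exact (Finset.abs_sum_le_sum_abs _ _).trans (Finset.sum_le_sum fun v _ => hpt v)
      _ = ε / 4 + 2 * M * m * ((Fintype.card V : ℝ)⁻¹ * ∑ v, u (x v)) := by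
          rw [Finset.sum_add_distrib, ← Finset.mul_sum, Finset.sum_comm,
            Finset.sum_congr rfl fun g _ => sum_pullbackName σ x g u]
          simp only [Finset.sum_const, Finset.card_univ, nsmul_eq_mul]
          rw [show (F.card : ℝ) = m from rfl]
          field_simp
      _ ≤ ε / 4 + 2 * M * m * (2 * η) := by gcongr
  dsimp only
  rw [abs_le] at h3 h4
  rw [abs_lt] at h2 ⊢
  constructor <;> nlinarith

end Retraction

/-! ### Entropy under injective measurable codings. -/

section Transfer

variable {G : Type u} [Group G] [Countable G]
  {X : Type*} [MetricSpace X] [CompactSpace X] [MeasurableSpace X] [BorelSpace X]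
  {Y : Type*} [MetricSpace Y] [CompactSpace Y] [MeasurableSpace Y] [BorelSpace Y]
  {φ : X → Y} {μ : ProbabilityMeasure (G → X)} {ρ : Measure X} [IsProbabilityMeasure ρ]

/-- The admissible sets `O` again form a filter, so functions of finitely many letters suffice as
tests. Composed with `φ`, they are continuous on configurations with letters in `K`. -/
theorem forRetracts_empirical_mem
    (hρ : ∀ g, Measure.map (fun z => z g) (μ : Measure (G → X)) = ρ) (hφ : Measurable φ)
    {ν : ProbabilityMeasure (G → Y)}
    (hν : Measure.map (fun z g => φ (z g)) (μ : Measure (G → X)) = ν)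
    {O : Set (ProbabilityMeasure (G → Y))} (hO : O ∈ 𝓝 ν) :
    ForRetracts.{u, w} φ μ ρ fun _ _ _ σ _ x' => empirical σ (fun v => φ (x' v)) ∈ O := by
  classical
  let 𝓕 : Filter (ProbabilityMeasure (G → Y)) :=
    { sets := {O | ForRetracts.{u, w} φ μ ρ fun _ _ _ σ _ x' =>
        empirical σ (fun v => φ (x' v)) ∈ O}
      univ_sets := ⟨1, one_pos, fun _ _ _ _ _ =>
        ⟨Set.univ, univ_mem, fun _ _ _ _ _ _ _ _ => trivial⟩⟩
      sets_of_superset := fun h hOO' => ForRetracts.mono h fun _ _ _ _ _ _ hx => hOO' hx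
      inter_sets := fun h h' => ForRetracts.and h h' }
  suffices h : Tendsto id 𝓕 (𝓝 ν) from h hO
  let M : Submonoid C(G → Y, ℝ) :=
    { carrier := {f | ∃ (F : Finset G) (h : C(F → Y, ℝ)), ∀ z, f z = h (fun g => z g)}
      one_mem' := ⟨∅, 1, fun _ => rfl⟩
      mul_mem' := by
        rintro f f' ⟨F, h, hf⟩ ⟨F', h', hf'⟩
        refine ⟨F ∪ F', ⟨fun y => h (fun g => y ⟨g, Finset.mem_union_left _ g.2⟩) *
          h' (fun g => y ⟨g, Finset.mem_union_right _ g.2⟩), by fun_prop⟩, fun z => ?_⟩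
        simp [hf, hf'] }
  refine tendsto_of_submonoid M ?_ ?_
  · intro x y hxy
    obtain ⟨g, hg⟩ := Function.ne_iff.1 hxy
    refine ⟨⟨fun z => dist (z g) (x g), by fun_prop⟩,
      ⟨{g}, ⟨fun z => dist (z ⟨g, by simp⟩) (x g), by fun_prop⟩, fun _ => rfl⟩, ?_⟩
    simpa using fun h => hg h.symm
  · rintro f ⟨F, h, hf⟩
    rw [Metric.tendsto_nhds]
    intro ε hε
    have hφF : Measurable fun (y : F → X) g => φ (y g) := by fun_prop
    have hφG : Measurable fun (z : G → X) g => φ (z g) := by fun_prop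
    refine (forRetracts_abs_average_sub_lt.{u, w} hρ F (h := fun y => h fun g => φ (y g))
      (h.continuous.measurable.comp hφF) (fun y => h.norm_coe_le_norm _) (fun K hK => ?_)
      hε).mono fun V _ _ σ x x' hx => ?_
    · refine h.continuous.comp_continuousOn (continuousOn_pi.2 fun g => ?_)
      exact hK.comp (continuous_apply g).continuousOn fun y hy => hy g
    · simp only [id, Set.mem_ofPred_eq, Real.dist_eq]
      rw [integral_empirical _ _ f.continuous.measurable.stronglyMeasurable, ← hν,
        integral_map hφG.aemeasurable f.continuous.measurable.aestronglyMeasurable]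
      simp_rw [hf]
      exact hx

/-- Sofic entropy does not decrease under an injective coding of single coordinates. -/
theorem processEntropy_le_of_map (S : SoficApprox.{u, w} G)
    (hρ : ∀ g, Measure.map (fun z => z g) (μ : Measure (G → X)) = ρ) (hφ : Measurable φ)
    {ψ : Y → X} (hψ : Measurable ψ) (hψφ : ∀ x, ψ (φ x) = x) {ν : ProbabilityMeasure (G → Y)}
    (hν : Measure.map (fun z g => φ (z g)) (μ : Measure (G → X)) = ν) :
    processEntropy S μ ≤ processEntropy S ν := by
  classical
  refine iSup₂_le fun δ hδ => ?_
  obtain ⟨t, -, htfin, ht⟩ := finite_cover_balls_of_compact (isCompact_univ (X := X))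
    (show 0 < δ / 16 by positivity)
  lift t to Finset X using htfin
  set e : ℝ := δ / (40 * (t.card + 1)) with he
  have he0 : 0 < e := by positivity
  have hte : t.card * (5 * e) ≤ δ / 8 := by
    rw [he]
    have : (0 : ℝ) ≤ t.card := by positivity
    rw [mul_div_assoc', mul_div_assoc', div_le_div_iff₀ (by positivity) (by positivity)]
    nlinarith
  have : IsProbabilityMeasure (ρ.map φ) := Measure.isProbabilityMeasure_map hφ.aemeasurable
  -- `ψ` need not be continuous, so the distance to `z` is recovered from `φ x` only up to an `L¹`
  -- error.
  have happrox : ∀ z : X, ∃ f : C(Y, ℝ), ∫ x, |dist x z - f (φ x)| ∂ρ ≤ e := by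
    intro z
    have hm : Measurable fun y => dist (ψ y) z := hψ.dist measurable_const
    have hi : Integrable (fun y => dist (ψ y) z) (ρ.map φ) :=
      integrable_of_bounded hm (B := Metric.diam (Set.univ : Set X)) fun y => by
        rw [abs_of_nonneg dist_nonneg]
        exact Metric.dist_le_diam_of_mem isCompact_univ.isBounded trivial trivial
    obtain ⟨f, hf, -⟩ := hi.exists_boundedContinuous_integral_sub_le he0
    refine ⟨f.toContinuousMap, ?_⟩
    have hn : Measurable fun y => ‖dist (ψ y) z - f y‖ := (hm.sub f.continuous.measurable).norm
    rw [integral_map hφ.aemeasurable hn.aestronglyMeasurable] at hf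
    simpa [hψφ] using hf
  choose f hf using happrox
  choose C hC0 hC using fun z => exists_modulus (f z) he0
  set Ct : ℝ := ∑ z ∈ t, C z with hCt
  have hCt0 : 0 ≤ Ct := Finset.sum_nonneg fun z _ => hC0 z
  set δ' : ℝ := δ / (16 * (Ct + 1)) with hδ'
  have hδ'0 : 0 < δ' := by positivity
  have hCδ : Ct * (2 * δ') ≤ δ / 8 := by
    rw [hδ', mul_div_assoc', mul_div_assoc', div_le_div_iff₀ (by positivity) (by positivity)]
    nlinarith
  refine le_iSup₂_of_le δ' hδ'0 (le_iInf₂ fun O' hO' => ?_)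
  -- The total recovery error over the finite net. It is continuous wherever `φ` is, so its average
  -- along retracted models is also controlled.
  let h : X → ℝ := fun x => ∑ z ∈ t, |dist x z - f z (φ x)|
  have hzm : ∀ z, Measurable fun x => |dist x z - f z (φ x)| := fun z =>
    ((measurable_id.dist measurable_const).sub ((f z).continuous.measurable.comp hφ)).abs
  have hzB : ∀ z x, |dist x z - f z (φ x)| ≤ Metric.diam (Set.univ : Set X) + ‖f z‖ := by
    intro z x
    have h1 := abs_sub (dist x z) (f z (φ x))
    have h2 := (f z).norm_coe_le_norm (φ x)
    rw [abs_of_nonneg dist_nonneg] at h1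
    rw [Real.norm_eq_abs] at h2
    have h3 := Metric.dist_le_diam_of_mem (isCompact_univ (X := X)).isBounded
      (Set.mem_univ x) (Set.mem_univ z)
    linarith
  have hhm : Measurable h := Finset.measurable_sum _ fun z _ => hzm z
  have hh0 : ∀ x, 0 ≤ h x := fun x => Finset.sum_nonneg fun z _ => abs_nonneg _
  have hhint : ∫ x, h x ∂ρ ≤ t.card * e := by
    rw [integral_finsetSum _ fun z _ => integrable_of_bounded (hzm z) (B := _) fun x => by
      rw [abs_abs]; exact hzB z x]
    exact (Finset.sum_le_card_nsmul _ _ e fun z _ => hf z).trans_eq (nsmul_eq_mul _ _)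
  have key := ((forRetracts_hammingAvg_lt.{u, w} (φ := φ) hρ (show 0 < δ / 8 by positivity)).and
    (forRetracts_empirical_mem.{u, w} hρ hφ hν hO')).and
    (forRetracts_abs_average_sub_lt.{u, w} (φ := φ) hρ {1} (h := fun y => h (y ⟨1, by simp⟩))
      (hhm.comp (measurable_pi_apply _)) (M := ∑ z ∈ t, (Metric.diam (Set.univ : Set X) + ‖f z‖))
      (fun y => by
        rw [abs_of_nonneg (hh0 _)]
        exact Finset.sum_le_sum fun z _ => hzB z _)
      (fun K hK => by
        have hk : ContinuousOn h K := continuousOn_finsetSum _ fun z _ =>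
          ((continuous_id.dist continuous_const).continuousOn.sub
            ((f z).continuous.comp_continuousOn hK)).abs
        exact hk.comp (continuous_apply _).continuousOn fun y hy => hy _)
      (show 0 < δ / 64 by positivity))
  obtain ⟨η, hη, key⟩ := key
  -- The bound `1 / 2` only ensures that `K` is non-empty.
  obtain ⟨K, hK, hφK, hKη⟩ := exists_isCompact_continuousOn ρ hφ (lt_min hη (one_half_pos (α := ℝ)))
  have hKne : K.Nonempty := by
    rw [Set.nonempty_iff_ne_empty]
    rintro rfl
    rw [Set.compl_empty, probReal_univ] at hKη
    linarith [hKη.trans (min_le_right _ _)]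
  obtain ⟨O, hO, key⟩ := key K hK hKne hφK (hKη.trans (min_le_left _ _))
  choose r hrK hr using fun x => hK.exists_infDist_eq_dist hKne x
  have hgood := fun (V : Type w) [Fintype V] [Nonempty V] (σ : G → Equiv.Perm V) (x : V → X)
    (hx : empirical σ x ∈ O) =>
    key V σ x (fun v => r (x v)) hx fun v => ⟨hrK _, (hr _).symm⟩
  -- Compare `x` and `y` through a net point `z` near `x`: the distance is at most `2 * dist x z`
  -- plus the difference of the distances to `z`, which the `f z` detect.
  have hdist : ∀ x y, dist x y ≤ δ / 8 + (h x + h y + t.card * e + Ct * dist (φ x) (φ y)) := by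
    intro x y
    obtain ⟨z, hz, hxz⟩ : ∃ z ∈ t, dist x z < δ / 16 := by
      simpa using ht (Set.mem_univ x)
    have h1 : |dist x z - dist y z| ≤ h x + h y + t.card * e + Ct * dist (φ x) (φ y) := by
      have a1 : |dist x z - f z (φ x)| ≤ h x :=
        Finset.single_le_sum (f := fun z => |dist x z - f z (φ x)|) (fun _ _ => abs_nonneg _) hz
      have a2 : |dist y z - f z (φ y)| ≤ h y :=
        Finset.single_le_sum (f := fun z => |dist y z - f z (φ y)|) (fun _ _ => abs_nonneg _) hz
      have a3 := hC z (φ x) (φ y)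
      have a4 : C z * dist (φ x) (φ y) ≤ Ct * dist (φ x) (φ y) := by
        gcongr
        exact Finset.single_le_sum (f := C) (fun z _ => hC0 z) hz
      have a5 : e ≤ t.card * e := by
        have : (1 : ℝ) ≤ t.card := by exact_mod_cast Finset.card_pos.2 ⟨z, hz⟩
        nlinarith
      rw [abs_le] at *
      constructor <;> linarith
    have h2 := dist_triangle x z y
    rw [dist_comm z y] at h2
    linarith [(abs_le.1 h1).1]
  refine iInf₂_le_of_le O hO (limsup_le_limsup (Eventually.of_forall fun n => rate_mono ?_))
  refine cov_le_of_mapsTo (fun x v => φ (r (x v))) (fun x hx => (hgood _ _ x hx).1.2) ?_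
  intro x hx y hy hxy
  have havg : ∀ x ∈ goodModels O (S.σ n),
      (Fintype.card (S.V n) : ℝ)⁻¹ * ∑ v, h (r (x v)) < t.card * e + δ / 64 := by
    intro x hx
    have h1 := (hgood _ _ x hx).2
    dsimp only at h1
    rw [integral_apply_eq (hρ 1) hhm, sum_pullbackName (S.σ n) (fun v => r (x v)) 1 h] at h1
    linarith [(abs_lt.1 h1).2]
  have h1 : hammingAvg x (fun v => r (x v)) < δ / 8 := (hgood _ _ x hx).1.1
  have h2 : hammingAvg y (fun v => r (y v)) < δ / 8 := (hgood _ _ y hy).1.1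
  have hcard : (0 : ℝ) < Fintype.card (S.V n) := by exact_mod_cast Fintype.card_pos
  have h3 : hammingAvg (fun v => r (x v)) (fun v => r (y v)) ≤
      δ / 8 + ((Fintype.card (S.V n) : ℝ)⁻¹ * ∑ v, h (r (x v)) +
        (Fintype.card (S.V n) : ℝ)⁻¹ * ∑ v, h (r (y v)) + t.card * e +
        Ct * hammingAvg (fun v => φ (r (x v))) (fun v => φ (r (y v)))) := by
    calc hammingAvg (fun v => r (x v)) (fun v => r (y v))
        ≤ (Fintype.card (S.V n) : ℝ)⁻¹ * ∑ v, (δ / 8 + (h (r (x v)) + h (r (y v)) + t.card * e +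
          Ct * dist (φ (r (x v))) (φ (r (y v))))) := by
          rw [hammingAvg]
          gcongr with v
          exact hdist _ _
      _ = _ := by
          simp only [hammingAvg, Finset.sum_add_distrib, ← Finset.mul_sum, Finset.sum_const,
            Finset.card_univ, nsmul_eq_mul]
          field_simp
  have h4 := hammingAvg_triangle x (fun v => r (x v)) y
  have h5 := hammingAvg_triangle (fun v => r (x v)) (fun v => r (y v)) y
  rw [hammingAvg_comm (fun v => r (y v)) y] at h5
  have h6 : Ct * hammingAvg (fun v => φ (r (x v))) (fun v => φ (r (y v))) ≤ Ct * (2 * δ') := by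
    gcongr
  linarith [havg x hx, havg y hy]

end Transfer

/-! ### From processes to `G`-systems. -/

section Systems

variable {G : Type u} [Group G] {X Y : Type*} [MeasurableSpace X] [MeasurableSpace Y]
  [MulAction G X] [MeasurableConstSMul G X] [MulAction G Y] [MeasurableConstSMul G Y]

theorem coe_orbitLaw (μ : ProbabilityMeasure X) :
    (orbitLaw G μ : Measure (G → X)) = Measure.map (fun x h => h • x) (μ : Measure X) := rfl

theorem measurable_orbit : Measurable fun (x : X) (h : G) => h • x :=
  measurable_pi_lambda _ fun h => measurable_const_smul h

theorem smulInvariantMeasure_prod (μ : ProbabilityMeasure X) (ν : ProbabilityMeasure Y)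
    [SMulInvariantMeasure G X (μ : Measure X)] [SMulInvariantMeasure G Y (ν : Measure Y)] :
    SMulInvariantMeasure G (X × Y) (μ.prod ν : Measure (X × Y)) :=
  ⟨fun g _ hs => ((measurePreserving_smul g (μ : Measure X)).prod
    (measurePreserving_smul g (ν : Measure Y))).measure_preimage hs.nullMeasurableSet⟩

theorem orbitLaw_map_apply (μ : ProbabilityMeasure X) [SMulInvariantMeasure G X (μ : Measure X)]
    (g : G) : Measure.map (fun z => z g) (orbitLaw G μ : Measure (G → X)) = μ := by
  rw [coe_orbitLaw, Measure.map_map (measurable_pi_apply g) measurable_orbit]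
  exact (measurePreserving_smul g (μ : Measure X)).map_eq

theorem orbitLaw_map (μ : ProbabilityMeasure X) {φ : X → Y} (hφ : Measurable φ)
    (hequiv : ∀ (g : G) x, φ (g • x) = g • φ x) {ν : ProbabilityMeasure Y}
    (hν : Measure.map φ (μ : Measure X) = ν) :
    Measure.map (fun z g => φ (z g)) (orbitLaw G μ : Measure (G → X)) = orbitLaw G ν := by
  rw [coe_orbitLaw, coe_orbitLaw, ← hν, Measure.map_map (by fun_prop) measurable_orbit,
    Measure.map_map measurable_orbit hφ]
  congr 1
  ext x g
  exact hequiv g x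

/-- Both sides push `μ × ν` forward by the same orbit map; this lets the bounds for joinings of
processes apply to product systems. -/
theorem joining_orbitLaw (μ : ProbabilityMeasure X) (ν : ProbabilityMeasure Y) :
    joining (orbitLaw G μ) (orbitLaw G ν) = orbitLaw G (μ.prod ν) := by
  apply Subtype.ext
  change (joining (orbitLaw G μ) (orbitLaw G ν) : Measure (G → X × Y)) =
    (orbitLaw G (μ.prod ν) : Measure (G → X × Y))
  rw [coe_joining, coe_orbitLaw, coe_orbitLaw, coe_orbitLaw,
    Measure.map_prod_map _ _ measurable_orbit measurable_orbit,
    Measure.map_map (by fun_prop) (measurable_orbit.prodMap measurable_orbit)]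
  rfl

variable [Countable G]

/-- Sofic entropy does not depend on the compact generating metric and is monotone under
equivariant injective codings. -/
theorem soficEntropy_le_of_map (S : SoficApprox.{u, w} G) (dX : CompactGeneratingMetric X)
    (dY : CompactGeneratingMetric Y) (μ : ProbabilityMeasure X)
    [SMulInvariantMeasure G X (μ : Measure X)] {φ : X → Y} (hφ : Measurable φ)
    {ψ : Y → X} (hψ : Measurable ψ) (hψφ : ∀ x, ψ (φ x) = x)
    (hequiv : ∀ (g : G) x, φ (g • x) = g • φ x) {ν : ProbabilityMeasure Y}
    (hν : Measure.map φ (μ : Measure X) = ν) : soficEntropy S dX μ ≤ soficEntropy S dY ν := by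
  let := dX.metric
  have := dX.compact
  have := dX.borel
  let := dY.metric
  have := dY.compact
  have := dY.borel
  exact processEntropy_le_of_map S (orbitLaw_map_apply μ) hφ hψ hψφ (orbitLaw_map μ hφ hequiv hν)

theorem soficEntropy_eq (S : SoficApprox.{u, w} G) (d d' : CompactGeneratingMetric X)
    (μ : ProbabilityMeasure X) [SMulInvariantMeasure G X (μ : Measure X)] :
    soficEntropy S d μ = soficEntropy S d' μ :=
  le_antisymm
    (soficEntropy_le_of_map S d d' μ measurable_id measurable_id (fun _ => rfl) (fun _ _ => rfl)
      Measure.map_id)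
    (soficEntropy_le_of_map S d' d μ measurable_id measurable_id (fun _ => rfl) (fun _ _ => rfl)
      Measure.map_id)

/-- The product (maximum) of two compact generating metrics. -/
def CompactGeneratingMetric.prod (dX : CompactGeneratingMetric X)
    (dY : CompactGeneratingMetric Y) : CompactGeneratingMetric (X × Y) :=
  letI := dX.metric
  haveI := dX.compact
  haveI := dX.borel
  letI := dY.metric
  haveI := dY.compact
  haveI := dY.borel
  ⟨inferInstance, inferInstance, inferInstance⟩

theorem soficEntropy_prod_le (S : SoficApprox.{u, w} G) (dX : CompactGeneratingMetric X)
    (dY : CompactGeneratingMetric Y) (μ : ProbabilityMeasure X) (ν : ProbabilityMeasure Y) :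
    soficEntropy S (dX.prod dY) (μ.prod ν) ≤ soficEntropy S dX μ + soficEntropy S dY ν := by
  let := dX.metric
  have := dX.compact
  have := dX.borel
  let := dY.metric
  have := dY.compact
  have := dY.borel
  change processEntropy S (orbitLaw G (μ.prod ν)) ≤ _
  rw [← joining_orbitLaw]
  exact processEntropy_le_add S _ _ _ (joining_map_fst _ _) (joining_map_snd _ _)

theorem dqEntropy_add_lowerSoficEntropy_le (S : SoficApprox.{u, w} G)
    (dX : CompactGeneratingMetric X) (dY : CompactGeneratingMetric Y) (μ : ProbabilityMeasure X)
    (ν : ProbabilityMeasure Y) :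
    dqEntropy S dX μ + lowerSoficEntropy S dY ν ≤ soficEntropy S (dX.prod dY) (μ.prod ν) := by
  let := dX.metric
  have := dX.compact
  have := dX.borel
  let := dY.metric
  have := dY.compact
  have := dY.borel
  change _ ≤ processEntropy S (orbitLaw G (μ.prod ν))
  rw [← joining_orbitLaw]
  exact add_le_processEntropy_joining S _ _

theorem soficEntropy_prod_eq_add (S : SoficApprox.{u, w} G) (dX : CompactGeneratingMetric X)
    (dY : CompactGeneratingMetric Y) (μ : ProbabilityMeasure X) (ν : ProbabilityMeasure Y)
    (hμ : dqEntropy S dX μ = soficEntropy S dX μ)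
    (hν : lowerSoficEntropy S dY ν = soficEntropy S dY ν) :
    soficEntropy S (dX.prod dY) (μ.prod ν) = soficEntropy S dX μ + soficEntropy S dY ν :=
  le_antisymm (soficEntropy_prod_le S dX dY μ ν)
    (hμ ▸ hν ▸ dqEntropy_add_lowerSoficEntropy_le S dX dY μ ν)

theorem soficEntropy_prod_swap (S : SoficApprox.{u, w} G) (d : CompactGeneratingMetric (X × Y))
    (d' : CompactGeneratingMetric (Y × X)) (μ : ProbabilityMeasure X) (ν : ProbabilityMeasure Y)
    [SMulInvariantMeasure G X (μ : Measure X)] [SMulInvariantMeasure G Y (ν : Measure Y)] :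
    soficEntropy S d (μ.prod ν) = soficEntropy S d' (ν.prod μ) := by
  have := smulInvariantMeasure_prod (G := G) μ ν
  have := smulInvariantMeasure_prod (G := G) ν μ
  exact le_antisymm
    (soficEntropy_le_of_map S d d' _ measurable_swap measurable_swap (fun _ => rfl)
      (fun _ _ => rfl) Measure.prod_swap)
    (soficEntropy_le_of_map S d' d _ measurable_swap measurable_swap (fun _ => rfl)
      (fun _ _ => rfl) Measure.prod_swap)

end Systems

end SoficEntropy

theorem mainTheorem7
    {G : Type*} [Group G] [Countable G] (S : SoficEntropy.SoficApprox G)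
    {X : Type*} [MeasurableSpace X] [StandardBorelSpace X]
    [MulAction G X] [MeasurableConstSMul G X]
    {Y : Type*} [MeasurableSpace Y] [StandardBorelSpace Y]
    [MulAction G Y] [MeasurableConstSMul G Y]
    (μ : ProbabilityMeasure X) [SMulInvariantMeasure G X (μ : Measure X)]
    (ν : ProbabilityMeasure Y) [SMulInvariantMeasure G Y (ν : Measure Y)]
    (dX : SoficEntropy.CompactGeneratingMetric X)
    (dY : SoficEntropy.CompactGeneratingMetric Y)
    (dXY : SoficEntropy.CompactGeneratingMetric (X × Y))
    (h : (SoficEntropy.dqEntropy S dX μ = SoficEntropy.soficEntropy S dX μ ∧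
            SoficEntropy.lowerSoficEntropy S dY ν = SoficEntropy.soficEntropy S dY ν) ∨
          (SoficEntropy.dqEntropy S dY ν = SoficEntropy.soficEntropy S dY ν ∧
            SoficEntropy.lowerSoficEntropy S dX μ = SoficEntropy.soficEntropy S dX μ)) :
    SoficEntropy.soficEntropy S dXY (μ.prod ν) =
      SoficEntropy.soficEntropy S dX μ + SoficEntropy.soficEntropy S dY ν := by
  have := SoficEntropy.smulInvariantMeasure_prod (G := G) μ ν
  rcases h with ⟨h, h'⟩ | ⟨h, h'⟩
  · rw [SoficEntropy.soficEntropy_eq S dXY (dX.prod dY),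
      SoficEntropy.soficEntropy_prod_eq_add S dX dY μ ν h h']
  · rw [SoficEntropy.soficEntropy_prod_swap S dXY (dY.prod dX),
      SoficEntropy.soficEntropy_prod_eq_add S dY dX ν μ h h', add_comm]
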